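/- Let $n\ge 3$ be an integer and let $m\ge 4$ be an even integer such that $n\cdot\frac{2\pi}{m}<(n-2)\pi$, so that there is a regular hyperbolic $n$-gon $\Delta_{n,m}\subset\mathbb{H}^2$ (in curvature $-1$) all of whose interior angles are $\frac{2\pi}{m}$. Let $$\Gamma_{n,m}=\left\langle r_1,\dots,r_n \ \middle|\ r_i^2=(r_ir_{i+1})^{m/2}=e\right\rangle$$ (indices mod $n$), acting on $\mathbb{H}^2$ so that $r_1,\dots,r_n$ act as the reflections in the consecutive sides of $\Delta_{n,m}$. For $x_0\in\mathbb{H}^2$ put $d_{\mathbb{H}^2}(g,g')=d_{\mathbb{H}^2}(g.x_0,g'.x_0)$ for $g,g'\in\Gamma_{n,m}$ (this is a left-invariant distance on $\Gamma_{n,m}$ when $x_0$ has trivial stabilizer). Then, for every $x_0\in\mathbb{H}^2$, all balls $B_R=\{g\in\Gamma_{n,m} : d_{\mathbb{H}^2}(e,g)\le R\}$ are finite, and the logarithmic volume of $(\Gamma_{n,m},d_{\mathbb{H}^2})$ equals $1$: $$v=\lim_{k\to\infty}\frac{\log|B_k|}{k}=1 .$$ -/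

import Mathlib

namespace HypCoxeter

noncomputable section

open Real Filter Topology UpperHalfPlane
open scoped MatrixGroups

/-! ### Logarithmic volume of a group with a distance -/

/-- The ball `B_R = {g ∈ G : d(e, g) ≤ R}` around the identity. -/
def groupBall {G : Type*} [Group G] (d : G → G → ℝ) (R : ℝ) : Set G :=
  {g | d 1 g ≤ R}

/-- `(G, d)` has logarithmic volume `v`: all balls `B_R` are finite and
`log |B_k| / k → v` as `k → ∞`. -/
def HasLogVolume {G : Type*} [Group G] (d : G → G → ℝ) (v : ℝ) : Prop :=
  (∀ R : ℝ, (groupBall d R).Finite) ∧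
    Tendsto (fun k : ℕ => Real.log ((groupBall d k).ncard : ℝ) / (k : ℝ)) atTop (𝓝 v)

/-! ### The Coxeter group `Γ_{n,m}` -/

/-- The relators `r_i ^ 2` and `(r_i r_{i+1}) ^ (m / 2)`, with indices taken cyclically mod `n`. -/
def relators (n m : ℕ) : Set (FreeGroup (ZMod n)) :=
  {w | ∃ i : ZMod n, w = FreeGroup.of i ^ 2} ∪
    {w | ∃ i : ZMod n, w = (FreeGroup.of i * FreeGroup.of (i + 1)) ^ (m / 2)}

/-- `Γ_{n,m} = ⟨r_1, …, r_n | r_i ^ 2 = (r_i r_{i+1}) ^ (m / 2) = e⟩`. -/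
abbrev Gam (n m : ℕ) : Type := PresentedGroup (relators n m)

/-- The pairs `(n, m)` considered: `m ≥ 4` is even and a hyperbolic `n`-gon all of whose interior
angles are `2π/m` exists, i.e. the sum of the interior angles is less than `(n - 2)π`. -/
structure IsHyperbolicPair (n m : ℕ) : Prop where
  three_le : 3 ≤ n
  four_le : 4 ≤ m
  even : Even m
  angle_sum : (n : ℝ) * (2 * π / m) < ((n : ℝ) - 2) * π

/-! ### The regular polygon `Δ_{n,m}` and the reflections in its sides

The hyperbolic plane is the upper half-plane `ℍ` with Mathlib's distance (curvature `-1`), on which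
`PGL(2, ℝ)` acts as the full isometry group (matrices of negative determinant act through
`z ↦ (a * conj z + b) / (c * conj z + d)`).  The polygon is centred at the point `i`. -/

/-- The matrix of the rotation about `i` by the angle `θ`. -/
def rotMat (θ : ℝ) : GL (Fin 2) ℝ :=
  Matrix.GeneralLinearGroup.mkOfDetNeZero
    !![cos (θ / 2), sin (θ / 2); -sin (θ / 2), cos (θ / 2)] (by
      rw [Matrix.det_fin_two_of]
      have := sin_sq_add_cos_sq (θ / 2)
      intro h
      nlinarith)

/-- The rotation of `ℍ` about `i` by the angle `θ`. -/
def rot (θ : ℝ) : PGL(2, ℝ) := Matrix.ProjGenLinGroup.mk (rotMat θ)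

/-- The matrix of the inversion `z ↦ e^{2a} / conj z`. -/
def mirrorMat (a : ℝ) : GL (Fin 2) ℝ :=
  Matrix.GeneralLinearGroup.mkOfDetNeZero !![0, exp a; exp (-a), 0] (by
    rw [Matrix.det_fin_two_of, ← exp_add]
    simp)

/-- The reflection of `ℍ` in the geodesic `|z| = e^a`, which is orthogonal to the imaginary axis
and passes through the point `e^a i` at distance `a` from `i`. -/
def mirror (a : ℝ) : PGL(2, ℝ) := Matrix.ProjGenLinGroup.mk (mirrorMat a)

/-- The distance from the centre of the regular `n`-gon with interior angles `2π/m` to its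
sides. -/
def inradius (n m : ℕ) : ℝ := arcosh (cos (π / m) / sin (π / n))

/-- The distance from the centre of the regular `n`-gon with interior angles `2π/m` to its
vertices. -/
def circumradius (n m : ℕ) : ℝ := arcosh (Real.cot (π / n) * Real.cot (π / m))

/-- The point at distance `R` from `i` in the direction with angle `θ` (anticlockwise from the
upward direction). -/
def polarPoint (R θ : ℝ) : ℍ := rotMat θ • (⟨⟨0, exp R⟩, exp_pos R⟩ : ℍ)

/-- The vertices of the regular polygon `Δ_{n,m}`, in cyclic order: vertex `k` has direction
`(2k+1)π/n` from the centre. -/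
def vertex (n m : ℕ) (k : ZMod n) : ℍ :=
  polarPoint (circumradius n m) ((2 * (k.val : ℝ) + 1) * (π / n))

/-- The reflection in the `k`-th side of `Δ_{n,m}`.  This is the side with end points
`vertex n m (k - 1)` and `vertex n m k`, whose midpoint has direction `2πk/n` from the centre; see
`sideReflection_fixes_vertex`, `sideReflection_succ_fixes_vertex` and
`interiorAngle_vertex` below. -/
def sideReflection (n m : ℕ) (k : ZMod n) : PGL(2, ℝ) :=
  rot (2 * (k.val : ℝ) * (π / n)) * mirror (inradius n m) * (rot (2 * (k.val : ℝ) * (π / n)))⁻¹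

/-- The angle at `B` of the hyperbolic triangle `ABC`, by the hyperbolic law of cosines. -/
def hypAngle (A B C : ℍ) : ℝ :=
  arccos ((cosh (dist B A) * cosh (dist B C) - cosh (dist A C)) /
    (sinh (dist B A) * sinh (dist B C)))

/-! ### Elementary facts on the polygon and its reflections -/

lemma rotMat_val (θ : ℝ) :
    (rotMat θ).val = !![cos (θ / 2), sin (θ / 2); -sin (θ / 2), cos (θ / 2)] := rfl

lemma mirrorMat_val (a : ℝ) : (mirrorMat a).val = !![0, exp a; exp (-a), 0] := rfl

lemma rotMat_add (α β : ℝ) : rotMat (α + β) = rotMat α * rotMat β := by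
  apply Units.ext
  rw [Units.val_mul, rotMat_val, rotMat_val, rotMat_val, add_div, cos_add, sin_add]
  ext i j
  fin_cases i <;> fin_cases j <;> simp [Matrix.mul_apply, Fin.sum_univ_two] <;> ring

lemma rot_add (α β : ℝ) : rot (α + β) = rot α * rot β := by
  simp [rot, rotMat_add]

lemma rotMat_two_pi : rotMat (2 * π) = -1 := by
  apply Units.ext
  rw [rotMat_val]
  ext i j
  fin_cases i <;> fin_cases j <;> simp

lemma rot_two_pi : rot (2 * π) = 1 := by
  rw [rot, rotMat_two_pi, Matrix.ProjGenLinGroup.mk_eq_one, Subgroup.mem_center_iff]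
  intro g
  simp

lemma rotMat_zero : rotMat 0 = 1 := by
  apply Units.ext
  rw [rotMat_val]
  ext i j
  fin_cases i <;> fin_cases j <;> simp

lemma rot_neg (θ : ℝ) : rot (-θ) = (rot θ)⁻¹ := by
  rw [eq_inv_iff_mul_eq_one, ← rot_add]
  simp [rot, rotMat_zero]

lemma rot_add_two_pi (θ : ℝ) : rot (θ + 2 * π) = rot θ := by
  rw [rot_add, rot_two_pi, mul_one]

lemma polarPoint_eq (R θ : ℝ) : polarPoint R θ = rot θ • polarPoint R 0 := by
  rw [polarPoint, polarPoint, rotMat_zero, one_smul, rot, pglMk_smul]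

lemma rot_smul_polarPoint (R α β : ℝ) : rot α • polarPoint R β = polarPoint R (α + β) := by
  rw [polarPoint_eq R β, polarPoint_eq R (α + β), smul_smul, rot_add]

lemma polarPoint_add_two_pi (R θ : ℝ) : polarPoint R (θ + 2 * π) = polarPoint R θ := by
  rw [polarPoint_eq, rot_add_two_pi, ← polarPoint_eq]

lemma polarPoint_re_im (R θ : ℝ) :
    (polarPoint R θ).re = sin (θ / 2) * cos (θ / 2) * (1 - exp R ^ 2) /
        (sin (θ / 2) ^ 2 * exp R ^ 2 + cos (θ / 2) ^ 2) ∧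
      (polarPoint R θ).im = exp R / (sin (θ / 2) ^ 2 * exp R ^ 2 + cos (θ / 2) ^ 2) := by
  have hdet : (rotMat θ).det.val = 1 := by
    rw [Matrix.GeneralLinearGroup.val_det_apply, rotMat_val, Matrix.det_fin_two_of]
    linarith [sin_sq_add_cos_sq (θ / 2)]
  have hc := coe_smul_of_det_pos (g := rotMat θ) (by rw [hdet]; norm_num)
    (⟨⟨0, exp R⟩, exp_pos R⟩ : ℍ)
  have h1 := sin_sq_add_cos_sq (θ / 2)
  constructor
  · rw [← coe_re, polarPoint, hc, num, denom, rotMat_val]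
    simp [Complex.div_re, Complex.normSq_apply, -Complex.ofReal_exp, -Complex.ofReal_cos,
      -Complex.ofReal_sin]
    rw [← add_div]
    congr 1 <;> ring
  · rw [← coe_im, polarPoint, hc, num, denom, rotMat_val]
    simp [Complex.div_im, Complex.normSq_apply, -Complex.ofReal_exp, -Complex.ofReal_cos,
      -Complex.ofReal_sin]
    rw [← sub_div]
    congr 1
    · linear_combination exp R * h1
    · ring

lemma sin_sq_mul_add_pos (R θ : ℝ) :
    0 < sin (θ / 2) ^ 2 * exp R ^ 2 + cos (θ / 2) ^ 2 := by
  have h1 := sin_sq_add_cos_sq (θ / 2)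
  by_cases h : cos (θ / 2) = 0
  · rw [h] at h1 ⊢
    have : sin (θ / 2) ^ 2 = 1 := by linarith
    rw [this]
    positivity
  · positivity

/-- Two points at distance `R` from `i` in directions `α`, `β`: hyperbolic law of cosines. -/
lemma cosh_dist_polarPoint (R α β : ℝ) :
    cosh (dist (polarPoint R α) (polarPoint R β)) =
      cosh R ^ 2 - sinh R ^ 2 * cos (α - β) := by
  obtain ⟨r1, i1⟩ := polarPoint_re_im R α
  obtain ⟨r2, i2⟩ := polarPoint_re_im R β
  have d1 := sin_sq_mul_add_pos R α
  have d2 := sin_sq_mul_add_pos R β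
  have hy := exp_pos R
  rw [cosh_dist, Complex.dist_eq, ← Complex.normSq_eq_norm_sq, Complex.normSq_apply,
    Complex.sub_re, Complex.sub_im, coe_re, coe_re, coe_im, coe_im, r1, i1, r2, i2]
  have hcos : cos (α - β) = 2 * (cos (α / 2) * cos (β / 2) + sin (α / 2) * sin (β / 2)) ^ 2 - 1 := by
    rw [← cos_sub, ← cos_two_mul]
    congr 1
    ring
  rw [hcos, cosh_eq, sinh_eq, exp_neg]
  have h1 : cos (α / 2) ^ 2 = 1 - sin (α / 2) ^ 2 := by linarith [sin_sq_add_cos_sq (α / 2)]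
  have h2 : cos (β / 2) ^ 2 = 1 - sin (β / 2) ^ 2 := by linarith [sin_sq_add_cos_sq (β / 2)]
  have h1' := sin_sq_add_cos_sq (α / 2)
  have h2' := sin_sq_add_cos_sq (β / 2)
  generalize sin (α / 2) = s at *
  generalize cos (α / 2) = c at *
  generalize sin (β / 2) = t at *
  generalize cos (β / 2) = d at *
  generalize exp R = y at *
  field_simp
  have d2' : y ^ 2 * t ^ 2 + d ^ 2 ≠ 0 := by
    rw [mul_comm (y ^ 2)]
    exact d2.ne'
  field_simp
  grind

/-- The mirror of `mirror a` consists of the points `z` with `|z| = e^a`. -/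
lemma mirror_smul_eq_self_iff (a : ℝ) (z : ℍ) :
    mirror a • z = z ↔ z.re ^ 2 + z.im ^ 2 = exp a ^ 2 := by
  have h0 := exp_pos a
  rw [mirror, pglMk_smul, gl_smul_eq_self_iff_dist_sq_eq]
  · rw [Complex.dist_eq, ← Complex.normSq_eq_norm_sq, Complex.normSq_apply, mirrorMat_val,
      Matrix.det_fin_two_of]
    simp [exp_neg, -Complex.ofReal_exp]
    rw [← pow_two, ← pow_two]
  · rw [mirrorMat_val, Matrix.det_fin_two_of, ← exp_add]
    simp
  · rw [mirrorMat_val]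
    simp [Matrix.trace_fin_two]
  · rw [mirrorMat_val]
    simp

lemma mirror_smul_polarPoint (a R θ : ℝ) (h : tanh a = tanh R * cos θ) :
    mirror a • polarPoint R θ = polarPoint R θ := by
  rw [mirror_smul_eq_self_iff]
  obtain ⟨r1, i1⟩ := polarPoint_re_im R θ
  rw [r1, i1]
  have d1 := sin_sq_mul_add_pos R θ
  have hc : cos θ = 2 * cos (θ / 2) ^ 2 - 1 := by
    rw [← cos_two_mul]
    congr 1
    ring
  have h1 : sin (θ / 2) ^ 2 = 1 - cos (θ / 2) ^ 2 := by linarith [sin_sq_add_cos_sq (θ / 2)]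
  rw [hc, tanh_eq_sinh_div_cosh, tanh_eq_sinh_div_cosh, cosh_eq, sinh_eq, cosh_eq, sinh_eq,
    exp_neg, exp_neg] at h
  have ha := exp_pos a
  have hR := exp_pos R
  generalize cos (θ / 2) = c at *
  generalize sin (θ / 2) = s at *
  generalize exp R = y at *
  generalize exp a = q at *
  field_simp at h ⊢
  have hq : q ^ 2 * (y ^ 2 * s ^ 2 + c ^ 2) = c ^ 2 * y ^ 2 + s ^ 2 := by
    rw [h1]
    linarith
  rw [div_eq_iff (by rw [mul_comm (y ^ 2)]; positivity), pow_two (y ^ 2 * s ^ 2 + c ^ 2),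
    ← mul_assoc, hq]
  have hy2 : y ^ 2 = y ^ 2 * (s ^ 2 + c ^ 2) ^ 2 := by rw [h1]; ring
  linear_combination hy2

lemma sideReflection_sq (n m : ℕ) (k : ZMod n) : sideReflection n m k ^ 2 = 1 := by
  have h : mirror (inradius n m) ^ 2 = 1 := by
    rw [mirror, ← map_pow]
    have : mirrorMat (inradius n m) ^ 2 = 1 := by
      apply Units.ext
      rw [pow_two, Units.val_mul, mirrorMat_val]
      ext i j
      fin_cases i <;> fin_cases j <;> simp [Matrix.mul_apply, Fin.sum_univ_two, ← exp_add]
    rw [this, map_one]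
  rw [sideReflection, conj_pow, h]
  simp

/-- Powers of a `2 × 2` matrix of determinant one and trace `2 cos ψ`. -/
lemma sin_smul_pow (A : Matrix (Fin 2) (Fin 2) ℝ) (ψ : ℝ) (hdet : A.det = 1)
    (htr : A.trace = 2 * cos ψ) (k : ℕ) :
    sin ψ • A ^ (k + 1) = sin ((k + 1) * ψ) • A - sin (k * ψ) • 1 := by
  have hA : A * A = (2 * cos ψ) • A - 1 := by
    rw [← htr]
    rw [Matrix.det_fin_two] at hdet
    ext i j
    fin_cases i <;> fin_cases j <;>
      simp [Matrix.mul_apply, Fin.sum_univ_two, Matrix.trace_fin_two] <;> linarith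
  induction k with
  | zero => simp
  | succ k ih =>
    rw [pow_succ, ← Matrix.smul_mul, ih, Matrix.sub_mul, Matrix.smul_mul, Matrix.smul_mul, hA,
      Matrix.one_mul]
    have h1 : sin (((k + 1 : ℕ) + 1 : ℝ) * ψ) =
        2 * cos ψ * sin ((k + 1) * ψ) - sin (k * ψ) := by
      have e1 : (((k + 1 : ℕ) + 1 : ℝ) * ψ) = (k + 1) * ψ + ψ := by push_cast; ring
      have e2 : (k : ℝ) * ψ = (k + 1) * ψ - ψ := by ring
      rw [e1, e2, sin_add, sin_sub]; ring
    rw [h1]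
    push_cast
    module

section facts

variable {n m : ℕ}

lemma IsHyperbolicPair.angles (h : IsHyperbolicPair n m) :
    0 < π / n ∧ 0 < π / m ∧ π / n + π / m < π / 2 := by
  have hn : (3 : ℝ) ≤ n := by exact_mod_cast h.three_le
  have hm : (4 : ℝ) ≤ m := by exact_mod_cast h.four_le
  refine ⟨by positivity, by positivity, ?_⟩
  have h1 := h.angle_sum
  have : (n : ℝ) * (2 * π / m) = 2 * n * (π / m) := by ring
  have h2 : (n : ℝ) * (π / n) = π := by field_simp
  have h3 : 0 < (n : ℝ) := by linarith
  by_contra hc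
  push Not at hc
  have := mul_le_mul_of_nonneg_left hc h3.le
  nlinarith

lemma cosh_inradius (h : IsHyperbolicPair n m) :
    cosh (inradius n m) = cos (π / m) / sin (π / n) := by
  obtain ⟨h1, h2, h3⟩ := h.angles
  apply cosh_arcosh
  have hs : 0 < sin (π / n) := sin_pos_of_pos_of_lt_pi h1 (by linarith)
  rw [one_le_div hs, ← cos_pi_div_two_sub]
  exact cos_le_cos_of_nonneg_of_le_pi h2.le (by linarith) (by linarith)

lemma inradius_nonneg (h : IsHyperbolicPair n m) : 0 ≤ inradius n m := by
  obtain ⟨h1, h2, h3⟩ := h.angles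
  apply arcosh_nonneg
  have hs : 0 < sin (π / n) := sin_pos_of_pos_of_lt_pi h1 (by linarith)
  rw [one_le_div hs, ← cos_pi_div_two_sub]
  exact cos_le_cos_of_nonneg_of_le_pi h2.le (by linarith) (by linarith)

lemma one_lt_cot_mul_cot (h : IsHyperbolicPair n m) :
    1 < Real.cot (π / n) * Real.cot (π / m) := by
  obtain ⟨h1, h2, h3⟩ := h.angles
  have hs : 0 < sin (π / n) := sin_pos_of_pos_of_lt_pi h1 (by linarith)
  have hs' : 0 < sin (π / m) := sin_pos_of_pos_of_lt_pi h2 (by linarith)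
  have hc : 0 < cos (π / n + π / m) := cos_pos_of_mem_Ioo ⟨by linarith, h3⟩
  rw [cos_add] at hc
  rw [Real.cot_eq_cos_div_sin, Real.cot_eq_cos_div_sin, div_mul_div_comm,
    one_lt_div (by positivity)]
  linarith

lemma cosh_circumradius (h : IsHyperbolicPair n m) :
    cosh (circumradius n m) = Real.cot (π / n) * Real.cot (π / m) :=
  cosh_arcosh (one_lt_cot_mul_cot h).le

lemma circumradius_pos (h : IsHyperbolicPair n m) : 0 < circumradius n m :=
  arcosh_pos (one_lt_cot_mul_cot h)

/-- The right-angled triangle centre, midpoint of a side, vertex. -/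
lemma tanh_inradius (h : IsHyperbolicPair n m) :
    tanh (inradius n m) = tanh (circumradius n m) * cos (π / n) := by
  obtain ⟨h1, h2, h3⟩ := h.angles
  have hs : 0 < sin (π / n) := sin_pos_of_pos_of_lt_pi h1 (by linarith)
  have hs' : 0 < sin (π / m) := sin_pos_of_pos_of_lt_pi h2 (by linarith)
  have hc : 0 < cos (π / n) := cos_pos_of_mem_Ioo ⟨by linarith, by linarith⟩
  have hc' : 0 < cos (π / m) := cos_pos_of_mem_Ioo ⟨by linarith, by linarith⟩
  have e1 : 0 ≤ sinh (inradius n m) := sinh_nonneg_iff.2 (inradius_nonneg h)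
  have e2 : 0 ≤ sinh (circumradius n m) := sinh_nonneg_iff.2 (circumradius_pos h).le
  have c1 := cosh_pos (inradius n m)
  have c2 := cosh_pos (circumradius n m)
  rw [tanh_eq_sinh_div_cosh, tanh_eq_sinh_div_cosh]
  rw [← sq_eq_sq₀ (by positivity) (by positivity), mul_pow, div_pow, div_pow, sinh_sq, sinh_sq,
    cosh_inradius h, cosh_circumradius h, Real.cot_eq_cos_div_sin, Real.cot_eq_cos_div_sin]
  have t1 := sin_sq_add_cos_sq (π / n)
  have t2 := sin_sq_add_cos_sq (π / m)
  field_simp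
  have u1 : sin (π / n) ^ 2 = 1 - cos (π / n) ^ 2 := by linarith
  have u2 : sin (π / m) ^ 2 = 1 - cos (π / m) ^ 2 := by linarith
  rw [u1, u2]
  ring

lemma val_succ (h : IsHyperbolicPair n m) (k : ZMod n) :
    ((k + 1).val : ℝ) = k.val + 1 ∨ ((k + 1).val : ℝ) = k.val + 1 - n := by
  have h3 := h.three_le
  have : NeZero n := ⟨by omega⟩
  have : Fact (1 < n) := ⟨by omega⟩
  have h1 := ZMod.val_add k 1
  rw [ZMod.val_one] at h1
  have h2 := ZMod.val_lt k
  by_cases hk : k.val + 1 < n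
  · left
    rw [h1, Nat.mod_eq_of_lt hk]
    push_cast
    ring
  · right
    have hk' : k.val + 1 = n := by omega
    have hk2 : (k.val : ℝ) + 1 = n := by exact_mod_cast hk'
    rw [h1, hk', Nat.mod_self, hk2]
    simp

lemma vertex_succ (h : IsHyperbolicPair n m) (k : ZMod n) :
    vertex n m (k + 1) =
      polarPoint (circumradius n m) ((2 * (k.val : ℝ) + 1) * (π / n) + 2 * (π / n)) := by
  have hn : (n : ℝ) * (π / n) = π := by
    have := h.three_le
    have : (n : ℝ) ≠ 0 := by positivity
    field_simp
  rw [vertex]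
  rcases val_succ h k with e | e
  · rw [e]
    congr 1
    ring
  · rw [e, ← polarPoint_add_two_pi]
    congr 1
    linear_combination -2 * hn

lemma sideReflection_succ (h : IsHyperbolicPair n m) (k : ZMod n) :
    sideReflection n m (k + 1) =
      rot (2 * (k.val : ℝ) * (π / n) + 2 * (π / n)) * mirror (inradius n m) *
        (rot (2 * (k.val : ℝ) * (π / n) + 2 * (π / n)))⁻¹ := by
  have hn : (n : ℝ) * (π / n) = π := by
    have := h.three_le
    have : (n : ℝ) ≠ 0 := by positivity
    field_simp
  have : rot (2 * ((k + 1).val : ℝ) * (π / n)) =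
      rot (2 * (k.val : ℝ) * (π / n) + 2 * (π / n)) := by
    rcases val_succ h k with e | e
    · rw [e]
      congr 1
      ring
    · rw [e, ← rot_add_two_pi]
      congr 1
      linear_combination -2 * hn
  rw [sideReflection, this]

/-- Vertex `k` is an end point of side `k`. -/
lemma sideReflection_fixes_vertex (h : IsHyperbolicPair n m) (k : ZMod n) :
    sideReflection n m k • vertex n m k = vertex n m k := by
  have e : vertex n m k = rot (2 * (k.val : ℝ) * (π / n)) •
      polarPoint (circumradius n m) (π / n) := by
    rw [rot_smul_polarPoint, vertex]
    congr 1
    ring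
  rw [sideReflection, e, smul_smul, inv_mul_cancel_right, mul_smul,
    mirror_smul_polarPoint _ _ _ (tanh_inradius h)]

/-- Vertex `k` is an end point of side `k + 1`. -/
lemma sideReflection_succ_fixes_vertex (h : IsHyperbolicPair n m) (k : ZMod n) :
    sideReflection n m (k + 1) • vertex n m k = vertex n m k := by
  have e : vertex n m k = rot (2 * (k.val : ℝ) * (π / n) + 2 * (π / n)) •
      polarPoint (circumradius n m) (-(π / n)) := by
    rw [rot_smul_polarPoint, vertex]
    congr 1
    ring
  rw [sideReflection_succ h, e, smul_smul, inv_mul_cancel_right, mul_smul,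
    mirror_smul_polarPoint _ _ _ (by rw [cos_neg]; exact tanh_inradius h)]

/-- All interior angles of `Δ_{n,m}` are `2π/m`. -/
lemma interiorAngle_vertex (h : IsHyperbolicPair n m) (k : ZMod n) :
    hypAngle (vertex n m k) (vertex n m (k + 1)) (vertex n m (k + 2)) = 2 * π / m := by
  obtain ⟨h1, h2, h3⟩ := h.angles
  set R := circumradius n m with hR
  have hRpos : 0 < R := circumradius_pos h
  have hs : 0 < sin (π / n) := sin_pos_of_pos_of_lt_pi h1 (by linarith)
  have hs' : 0 < sin (π / m) := sin_pos_of_pos_of_lt_pi h2 (by linarith)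
  have hch : cosh R * (sin (π / n) * sin (π / m)) = cos (π / n) * cos (π / m) := by
    rw [hR, cosh_circumradius h, Real.cot_eq_cos_div_sin, Real.cot_eq_cos_div_sin]
    field_simp
  have v1 := vertex_succ h k
  have v2 : vertex n m (k + 2) = polarPoint R ((2 * (k.val : ℝ) + 1) * (π / n) + 4 * (π / n)) := by
    have e : k + 2 = k + 1 + 1 := by ring
    rw [e, vertex_succ h]
    rcases val_succ h k with e | e
    · rw [e]
      congr 1
      ring
    · have hn : (n : ℝ) * (π / n) = π := by
        have := h.three_le
        have : (n : ℝ) ≠ 0 := by positivity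
        field_simp
      rw [e, ← polarPoint_add_two_pi]
      congr 1
      linear_combination -2 * hn
  have d1 : cosh (dist (vertex n m (k + 1)) (vertex n m k)) =
      cosh R ^ 2 - sinh R ^ 2 * cos (2 * (π / n)) := by
    rw [v1, vertex, cosh_dist_polarPoint]
    congr 3
    ring
  have d2 : cosh (dist (vertex n m (k + 1)) (vertex n m (k + 2))) =
      cosh R ^ 2 - sinh R ^ 2 * cos (2 * (π / n)) := by
    rw [v1, v2, cosh_dist_polarPoint, ← cos_neg]
    congr 3
    ring
  have d3 : cosh (dist (vertex n m k) (vertex n m (k + 2))) =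
      cosh R ^ 2 - sinh R ^ 2 * cos (2 * (2 * (π / n))) := by
    rw [v2, vertex, cosh_dist_polarPoint, ← cos_neg]
    congr 3
    ring
  have dd : dist (vertex n m (k + 1)) (vertex n m (k + 2)) =
      dist (vertex n m (k + 1)) (vertex n m k) :=
    cosh_injOn dist_nonneg dist_nonneg (by rw [d1, d2])
  have hS : sinh R ≠ 0 := (sinh_pos_iff.2 hRpos).ne'
  have hS2 := sinh_sq R
  set D := dist (vertex n m (k + 1)) (vertex n m k)
  have hcosD : cosh D = 1 + 2 * sinh R ^ 2 * sin (π / n) ^ 2 := by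
    rw [d1, cos_two_mul, cos_sq', cosh_sq]
    ring
  have hsD : sinh D ^ 2 = cosh D ^ 2 - 1 := sinh_sq D
  have hsD' : 0 < sinh D ^ 2 := by
    rw [hsD, hcosD]
    have : 0 < sinh R ^ 2 * sin (π / n) ^ 2 := by positivity
    nlinarith
  rw [hypAngle, dd, d3, ← pow_two, ← pow_two]
  rw [show 2 * π / (m : ℝ) = 2 * (π / m) by ring]
  rw [← arccos_cos (x := 2 * (π / m)) (by linarith) (by linarith)]
  congr 1
  rw [div_eq_iff hsD'.ne', hsD, hcosD, cos_two_mul (2 * (π / n)), cos_two_mul (π / n),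
    cos_two_mul (π / m), cosh_sq]
  have t1 := sin_sq_add_cos_sq (π / n)
  have t2 := sin_sq_add_cos_sq (π / m)
  have hch2 : (sinh R ^ 2 + 1) * (sin (π / n) ^ 2 * sin (π / m) ^ 2) =
      cos (π / n) ^ 2 * cos (π / m) ^ 2 := by
    rw [← cosh_sq, ← mul_pow, ← mul_pow, ← mul_pow, hch]
  generalize cos (π / n) ^ 2 = x at *
  generalize cos (π / m) ^ 2 = y at *
  rw [show sin (π / m) ^ 2 = 1 - y by linarith] at hch2
  rw [show x = 1 - sin (π / n) ^ 2 by linarith] at hch2 ⊢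
  linear_combination 8 * sinh R ^ 2 * sin (π / n) ^ 2 * hch2

/-- The relation `(r_k r_{k+1}) ^ (m / 2) = e`: the product is a rotation by `4π/m`. -/
lemma sideReflection_mul_succ_pow (h : IsHyperbolicPair n m) (k : ZMod n) :
    (sideReflection n m k * sideReflection n m (k + 1)) ^ (m / 2) = 1 := by
  obtain ⟨h1, h2, h3⟩ := h.angles
  set ψ := 2 * (π / n) with hψ
  set a := inradius n m with ha
  have e : sideReflection n m k * sideReflection n m (k + 1) =
      rot (2 * (k.val : ℝ) * (π / n)) * (mirror a * rot ψ * mirror a * rot (-ψ)) *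
        (rot (2 * (k.val : ℝ) * (π / n)))⁻¹ := by
    rw [sideReflection_succ h, sideReflection, rot_add, rot_neg, ← ha, ← hψ]
    generalize rot (2 * (k.val : ℝ) * (π / n)) = x
    group
  rw [e, conj_pow]
  set B : GL (Fin 2) ℝ := mirrorMat a * rotMat ψ * mirrorMat a * rotMat (-ψ) with hB
  have hBmk : mirror a * rot ψ * mirror a * rot (-ψ) = Matrix.ProjGenLinGroup.mk B := by
    simp [mirror, rot, hB]
  have hψ2 : ψ / 2 = π / n := by rw [hψ]; ring
  have sc := sin_sq_add_cos_sq (π / n)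
  have hval : B.val = !![cos (π / n) ^ 2 - exp a ^ 2 * sin (π / n) ^ 2,
      - (1 + exp a ^ 2) * (sin (π / n) * cos (π / n));
      (1 + exp (-a) ^ 2) * (sin (π / n) * cos (π / n)),
      cos (π / n) ^ 2 - exp (-a) ^ 2 * sin (π / n) ^ 2] := by
    have hee : exp a * exp (-a) = 1 := by rw [← exp_add]; simp
    rw [hB, Units.val_mul, Units.val_mul, Units.val_mul, mirrorMat_val, rotMat_val, rotMat_val,
      neg_div, cos_neg, sin_neg, hψ2]
    ext i j
    fin_cases i <;> fin_cases j <;> simp [Matrix.mul_apply, Fin.sum_univ_two] <;>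
      grind
  have hdet : B.val.det = 1 := by
    have hee : exp a * exp (-a) = 1 := by rw [← exp_add]; simp
    rw [hval, Matrix.det_fin_two_of]
    grind
  have hsin : sin (π / n) ≠ 0 := (sin_pos_of_pos_of_lt_pi h1 (by linarith)).ne'
  have htr : B.val.trace = 2 * cos (π - 2 * (π / m)) := by
    have hc := cosh_inradius h
    rw [← ha, cosh_eq] at hc
    have hee : exp a * exp (-a) = 1 := by rw [← exp_add]; simp
    rw [eq_div_iff hsin] at hc
    rw [hval, Matrix.trace_fin_two_of, cos_pi_sub, cos_two_mul]
    grind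
  obtain ⟨l, hl⟩ := h.even
  have hl1 : m / 2 = l := by omega
  have hl2 : 2 ≤ l := by have := h.four_le; omega
  obtain ⟨p, rfl⟩ : ∃ p, l = p + 1 := ⟨l - 1, by omega⟩
  have hmR : (m : ℝ) = 2 * (p + 1) := by rw [hl]; push_cast; ring
  set φ := π - 2 * (π / m) with hφ
  have hlφ : ((p : ℝ) + 1) * φ = p * π := by
    rw [hφ, hmR]
    field_simp
    ring
  have hφpos : sin φ ≠ 0 := by
    apply (sin_pos_of_pos_of_lt_pi _ _).ne' <;> linarith
  have hpow := sin_smul_pow B.val φ hdet htr p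
  have hpφ : (p : ℝ) * φ = p * π - φ := by linarith
  clear_value φ
  rw [hlφ, hpφ, sin_sub, sin_nat_mul_pi, zero_smul, zero_mul, zero_sub, zero_sub,
    _root_.neg_smul, neg_neg, mul_comm, mul_smul] at hpow
  have hpow' := smul_right_injective _ hφpos hpow
  have : Matrix.ProjGenLinGroup.mk (B ^ (p + 1)) = 1 := by
    rw [Matrix.ProjGenLinGroup.mk_eq_one,
      Matrix.GeneralLinearGroup.mem_center_iff_val_mem_range_scalar, Units.val_pow_eq_pow_val,
      hpow']
    exact ⟨cos (p * π), by simp [Matrix.smul_one_eq_diagonal]⟩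
  rw [hBmk, hl1, ← map_pow, this]
  simp

end facts

/-! ### The action of `Γ_{n,m}` on `ℍ` and the geometric distance -/

lemma lift_relators {n m : ℕ} (h : IsHyperbolicPair n m) :
    ∀ w ∈ relators n m, FreeGroup.lift (sideReflection n m) w = 1 := by
  rintro w (⟨i, rfl⟩ | ⟨i, rfl⟩)
  · simpa using sideReflection_sq n m i
  · simpa using sideReflection_mul_succ_pow h i

/-- The action of `Γ_{n,m}` on the hyperbolic plane, as a homomorphism to the isometry group: the
generator `r_k` acts as the reflection in the `k`-th side of `Δ_{n,m}`. -/
def action {n m : ℕ} (h : IsHyperbolicPair n m) : Gam n m →* PGL(2, ℝ) :=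
  PresentedGroup.toGroup (lift_relators h)

/-- The geometric distance `d(g, g') = d_{ℍ}(g.x₀, g'.x₀)` on `Γ_{n,m}` with base point `x₀`. -/
def geomDist {n m : ℕ} (h : IsHyperbolicPair n m) (x₀ : ℍ) (g g' : Gam n m) : ℝ :=
  dist (action h g • x₀) (action h g' • x₀)

end

end HypCoxeter

/-! The orbit of the centre `I` of the polygon is uniformly separated and relatively dense in `ℍ`.
Such an orbit has about `e^R` points in a ball of radius `R`, up to constants and a linear factor,
because hyperbolic area grows like `e^R`; the logarithm divided by `R` then tends to 1. Passing from
`I` to `x₀` shifts radii by at most `2 * dist I x₀`. Group elements are counted rather than orbit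
points, so the stabilizer of `x₀` plays no role.

Separation is the delicate half, since the group is given by a presentation: a nontrivial element
must be shown to move `I` by a definite amount. This is Tits's argument for the geometric
representation of a Coxeter group. In the hyperboloid model each side has a unit normal, and `F w i`
is the pairing of that normal with `w⁻¹ • I`. Right multiplication by a generator changes `F` by the
reflection formula, and induction on word length (`neg_of_len_le`) reduces signs to dihedral
subgroups, where they are signs of Chebyshev numbers. Adjacent sides give `cos (2π/m)`, matching the
relator; other pairs have coefficient at least 1 and need no relator. Hence for `g ≠ 1` the point `g
• I` lies strictly beyond some side, so at distance at least the inradius (`inradius_le_dist`).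

Density is a descent: reflecting in a side that separates a point from `I` lowers the time
coordinate, and a point beyond no side lies in a bounded set (`exists_dist_action_smul_le`). The
counts are elementary: a grid adapted to the half-plane bounds from above, equally spaced points on
a horocycle from below. -/

namespace HypCoxeter

noncomputable section

open Real Filter Topology UpperHalfPlane
open scoped MatrixGroups

/-! ### Groups generated by involutions acting like reflections -/

section Tits

variable {G ι : Type*} [Group G]

/-- The alternating product `… t s t` of length `p` in two elements, ending in `t`. -/
def alt : ℕ → G → G → G
  | 0, _, _ => 1
  | p + 1, s, t => alt p t s * t

/-- The numbers `U_p` with `U_0 = 0`, `U_1 = 1` and `U_{p+2} = 2 c U_{p+1} - U_p`. -/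
def cheb (c : ℝ) : ℕ → ℝ
  | 0 => 0
  | 1 => 1
  | p + 2 => 2 * c * cheb c (p + 1) - cheb c p

/-- When `(s * t) ^ p = 1` this becomes the braid relation: the two alternating products of length
`p` agree. -/
lemma alt_eq_alt_mul_pow (p : ℕ) : ∀ s t : G, s * s = 1 → t * t = 1 →
    alt p s t = alt p t s * (s * t) ^ p := by
  induction p with
  | zero => intro s t _ _; simp [alt]
  | succ p ih =>
    intro s t hs ht
    have h1 : ∀ k : ℕ, (t * s) ^ k * t = t * (s * t) ^ k := by
      intro k
      induction k with
      | zero => simp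
      | succ k ihk => rw [pow_succ', mul_assoc, ihk, pow_succ']; simp only [mul_assoc]
    have h2 : s * (s * t) ^ (p + 1) = t * (s * t) ^ p := by
      rw [pow_succ', ← mul_assoc, ← mul_assoc, hs, one_mul]
    rw [alt, alt, ih t s ht hs, mul_assoc, h1, mul_assoc, h2]

/-- An alternating product of positive length starts with one of the two letters; removing it
leaves a shorter alternating product, adding the other one gives a longer one. -/
lemma exists_alt_succ (p : ℕ) : ∀ s t : G, s * s = 1 → t * t = 1 →
    ∃ x y : G, (x = s ∧ y = t ∨ x = t ∧ y = s) ∧ x * alt (p + 1) s t = alt p s t ∧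
      y * alt (p + 1) s t = alt (p + 2) s t := by
  induction p with
  | zero => intro s t _ ht; exact ⟨t, s, Or.inr ⟨rfl, rfl⟩, by simp [alt, ht], by simp [alt]⟩
  | succ p ih =>
    intro s t hs ht
    obtain ⟨x, y, hxy, h1, h2⟩ := ih t s ht hs
    refine ⟨x, y, hxy.symm, ?_, ?_⟩
    · rw [alt, ← mul_assoc, h1, alt]
    · rw [alt, ← mul_assoc, h2]; rfl

variable {S : ι → G} {c : ι → ι → ℝ} {F : G → ι → ℝ} {len : G → ℕ}

/-- Values of `F` along alternating products. -/
lemma eval_mul_alt (hcomm : ∀ i j, c i j = c j i) (hdiag : ∀ i, c i i = -1)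
    (hF : ∀ w i j, F (w * S j) i = F w i + 2 * c i j * F w j) (v : G) (p : ℕ) :
    ∀ s t : ι,
      F (v * alt (2 * p) (S s) (S t)) s =
        cheb (c s t) (2 * p + 1) * F v s + cheb (c s t) (2 * p) * F v t ∧
      F (v * alt (2 * p + 1) (S s) (S t)) s =
        cheb (c s t) (2 * p + 1) * F v s + cheb (c s t) (2 * p + 2) * F v t := by
  -- The diagonal value `-1` makes the last letter flip the sign of its own root, so two reflection
  -- steps combine into the three-term recurrence of `cheb`.
  have hstep : ∀ p s t, F (v * alt (p + 2) (S s) (S t)) s =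
      2 * c s t * F (v * alt (p + 1) (S t) (S s)) t - F (v * alt p (S s) (S t)) s := by
    intro p s t
    rw [alt, ← mul_assoc, hF _ s t]
    have : F (v * alt (p + 1) (S t) (S s)) s = - F (v * alt p (S s) (S t)) s := by
      rw [alt, ← mul_assoc, hF, hdiag]; ring
    rw [this]; ring
  have hU : ∀ (p : ℕ) (d : ℝ), cheb d (p + 2) = 2 * d * cheb d (p + 1) - cheb d p := fun _ _ => rfl
  induction p with
  | zero =>
    intro s t
    constructor
    · simp [alt, cheb]
    · simp [alt, cheb, hF]
  | succ p ih =>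
    have hE : ∀ s t, F (v * alt (2 * p + 2) (S s) (S t)) s =
        cheb (c s t) (2 * p + 3) * F v s + cheb (c s t) (2 * p + 2) * F v t := by
      intro s t
      rw [hstep, (ih t s).2, (ih s t).1, hcomm t s, hU (2 * p + 1), hU (2 * p)]; ring
    intro s t
    refine ⟨hE s t, ?_⟩
    change F (v * alt (2 * p + 1 + 2) (S s) (S t)) s =
      cheb (c s t) (2 * p + 3) * F v s + cheb (c s t) (2 * p + 4) * F v t
    rw [hstep, hE t s, (ih s t).2, hcomm t s, hU (2 * p + 2), hU (2 * p + 1)]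
    ring

/-- The condition on the coefficient of a pair of generators which corresponds to the order of
their product: either the numbers `U_p` are all positive, or they are up to that order. -/
def DihedralCondition (c : ℝ) (g : G) : Prop :=
  (∀ p, 0 < p → 0 < cheb c p) ∨
    ∃ q : ℕ, 1 ≤ q ∧ g ^ q = 1 ∧ (∀ p, 0 < p → p < q → 0 < cheb c p) ∧ 0 ≤ cheb c q

/-- **The lemma of Tits**: if `w S_s` is not shorter than `w`, then the root `w α_s` is positive
(`F w s` is the value of this root at a base point). -/
theorem neg_of_len_le (hS : ∀ i, S i * S i = 1) (hcomm : ∀ i j, c i j = c j i)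
    (hdiag : ∀ i, c i i = -1)
    (hF : ∀ w i j, F (w * S j) i = F w i + 2 * c i j * F w j)
    (hF1 : ∀ i, F 1 i < 0) (hdih : ∀ i j, i ≠ j → DihedralCondition (c i j) (S i * S j))
    (hlen : ∀ w i, len (w * S i) ≤ len w + 1)
    (hdesc : ∀ w, w ≠ 1 → ∃ i, len (w * S i) < len w) (N : ℕ) :
    ∀ w s, len w = N → len w ≤ len (w * S s) → F w s < 0 := by
  have hlenalt : ∀ p v s t, len (v * alt p (S s) (S t)) ≤ len v + p := by
    intro p
    induction p with
    | zero => intro v s t; simp [alt]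
    | succ p ih =>
      intro v s t
      rw [alt, ← mul_assoc]
      have := hlen (v * alt p (S t) (S s)) t
      have := ih v t s
      omega
  induction N using Nat.strong_induction_on with
  | _ N IH =>
  intro w s hN hws
  by_cases hw : w = 1
  · rw [hw]; exact hF1 s
  obtain ⟨t, ht⟩ := hdesc w hw
  have hst : s ≠ t := by rintro rfl; omega
  -- decompositions `w = v * alt p` with additive lengths
  let P : ℕ → Prop := fun p => ∃ v, w = v * alt (p + 1) (S s) (S t) ∧ len v + (p + 1) = len w
  have hP0 : P 0 := by
    refine ⟨w * S t, by simp [alt, mul_assoc, hS], ?_⟩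
    have := hlen (w * S t) t
    rw [mul_assoc, hS, mul_one] at this
    omega
  -- Take the longest alternating tail in `s`, `t` that splits off with additive lengths; its length
  -- is at most `len w`.
  obtain ⟨p, ⟨v, hv, hvl⟩, hmax⟩ : ∃ p, P p ∧ ¬ P (p + 1) := by
    by_contra hcon
    push Not at hcon
    have hall : ∀ p, P p := fun p => Nat.rec hP0 (fun p hp => hcon p hp) p
    obtain ⟨v, -, h⟩ := hall (len w)
    omega
  obtain ⟨x, y, hxy, hx, hy⟩ := exists_alt_succ p (S s) (S t) (hS s) (hS t)
  -- both letters are ascents of `v`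
  have key : len v ≤ len (v * S s) ∧ len v ≤ len (v * S t) := by
    have hx' : ∀ i, S i = x → len v ≤ len (v * S i) := by
      intro i hi
      by_contra hlt
      have e : w = (v * S i) * alt p (S s) (S t) := by
        rw [hv, ← hx, ← hi, mul_assoc, ← mul_assoc (S i), hS, one_mul]
      have := hlenalt p (v * S i) s t
      rw [← e] at this
      omega
    have hy' : ∀ i, S i = y → len v ≤ len (v * S i) := by
      intro i hi
      by_contra hlt
      apply hmax
      refine ⟨v * S i, ?_, ?_⟩
      · rw [hv, ← hy, ← hi, mul_assoc, ← mul_assoc (S i), hS, one_mul]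
      · have := hlen (v * S i) i
        rw [mul_assoc, hS, mul_one] at this
        omega
    rcases hxy with ⟨h1, h2⟩ | ⟨h1, h2⟩
    · exact ⟨hx' s h1.symm, hy' t h2.symm⟩
    · exact ⟨hy' s h2.symm, hx' t h1.symm⟩
  have hs := IH (len v) (by omega) v s rfl key.1
  have ht := IH (len v) (by omega) v t rfl key.2
  -- positivity of the coefficients
  have hcoef : 0 < cheb (c s t) (p + 1) ∧ 0 ≤ cheb (c s t) (p + 2) := by
    rcases hdih s t hst with h | ⟨q, hq1, hq, hpos, hnn⟩
    · exact ⟨h _ (by omega), (h _ (by omega)).le⟩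
    · have hpq : p + 1 < q := by
        by_contra hge
        obtain ⟨r, rfl⟩ : ∃ r, q = r + 1 := ⟨q - 1, by omega⟩
        have hcut : ∀ k, ∃ u, alt (r + 1 + k) (S s) (S t) = u * alt (r + 1) (S s) (S t) ∧
            ∀ v, len (v * u) ≤ len v + k := by
          intro k
          induction k with
          | zero => exact ⟨1, by simp, by simp⟩
          | succ k ihk =>
            obtain ⟨u, hu, hul⟩ := ihk
            obtain ⟨x', y', hxy', -, hy'⟩ :=
              exists_alt_succ (r + k) (S s) (S t) (hS s) (hS t)
            have hi : ∃ i, y' = S i := by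
              rcases hxy' with ⟨-, h⟩ | ⟨-, h⟩
              · exact ⟨t, h⟩
              · exact ⟨s, h⟩
            obtain ⟨i, rfl⟩ := hi
            refine ⟨S i * u, ?_, ?_⟩
            · rw [mul_assoc, ← hu, show r + 1 + (k + 1) = r + k + 2 by ring, ← hy']
              congr 2; ring
            · intro v
              rw [← mul_assoc]
              have := hul (v * S i)
              have := hlen v i
              omega
        obtain ⟨u, hu, hul⟩ := hcut (p + 1 - (r + 1))
        rw [show r + 1 + (p + 1 - (r + 1)) = p + 1 by omega,
          alt_eq_alt_mul_pow (r + 1) _ _ (hS s) (hS t), hq, mul_one] at hu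
        have e : w * S s = (v * u) * alt r (S s) (S t) := by
          rw [hv, hu, alt]; simp only [mul_assoc, hS, mul_one]
        have h1 := hlenalt r (v * u) s t
        rw [← e] at h1
        have h2 := hul v
        omega
      refine ⟨hpos _ (by omega) hpq, ?_⟩
      rcases Nat.lt_or_ge (p + 2) q with h | h
      · exact (hpos _ (by omega) h).le
      · rw [show p + 2 = q by omega]; exact hnn
  rw [hv]
  -- The coefficients are `U_{p+1}` and `U_{p+2}`; parity only decides which of them multiplies `F v
  -- s`.
  rcases Nat.even_or_odd' (p + 1) with ⟨k, hk | hk⟩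
  · have e := (eval_mul_alt (S := S) hcomm hdiag hF v k s t).1
    rw [← hk] at e
    rw [e]
    nlinarith [hcoef.1, hcoef.2, mul_pos_of_neg_of_neg ht (neg_neg_of_pos hcoef.1),
      mul_nonneg_of_nonpos_of_nonpos hs.le (neg_nonpos.2 hcoef.2),
      show cheb (c s t) (p + 1 + 1) = cheb (c s t) (p + 2) from rfl]
  · have e := (eval_mul_alt (S := S) hcomm hdiag hF v k s t).2
    rw [show 2 * k + 2 = p + 2 by omega, ← hk] at e
    rw [e]
    nlinarith [hcoef.1, hcoef.2, mul_pos_of_neg_of_neg hs (neg_neg_of_pos hcoef.1),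
      mul_nonneg_of_nonpos_of_nonpos ht.le (neg_nonpos.2 hcoef.2)]

/-- Every element other than `1` makes some simple root negative. -/
theorem exists_pos_of_ne_one (hS : ∀ i, S i * S i = 1) (hgen : Subgroup.closure (Set.range S) = ⊤)
    (hcomm : ∀ i j, c i j = c j i) (hdiag : ∀ i, c i i = -1)
    (hF : ∀ w i j, F (w * S j) i = F w i + 2 * c i j * F w j)
    (hF1 : ∀ i, F 1 i < 0) (hdih : ∀ i j, i ≠ j → DihedralCondition (c i j) (S i * S j))
    (w : G) (hw : w ≠ 1) : ∃ i, 0 < F w i := by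
  have hex : ∀ w : G, ∃ k, ∃ l : List ι, l.length = k ∧ (l.map S).prod = w := by
    intro w
    have hwm : w ∈ Subgroup.closure (Set.range S) := by rw [hgen]; trivial
    induction hwm using Subgroup.closure_induction_right with
    | one => exact ⟨0, [], rfl, rfl⟩
    | mul_right x y hx hy ih =>
      obtain ⟨k, l, -, hl⟩ := ih
      obtain ⟨i, rfl⟩ := hy
      exact ⟨_, l ++ [i], rfl, by simp [hl]⟩
    | mul_inv_cancel x y hx hy ih =>
      obtain ⟨k, l, -, hl⟩ := ih
      obtain ⟨i, rfl⟩ := hy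
      refine ⟨_, l ++ [i], rfl, ?_⟩
      rw [inv_eq_of_mul_eq_one_right (hS i)]
      simp [hl]
  classical
  let len : G → ℕ := fun w => Nat.find (hex w)
  have hlen : ∀ w i, len (w * S i) ≤ len w + 1 := by
    intro w i
    obtain ⟨l, hl1, hl2⟩ := Nat.find_spec (hex w)
    exact Nat.find_min' _ ⟨l ++ [i], by simp [hl1, len], by simp [hl2]⟩
  have hdesc : ∀ w, w ≠ 1 → ∃ i, len (w * S i) < len w := by
    intro w hw
    obtain ⟨l, hl1, hl2⟩ := Nat.find_spec (hex w)
    rcases List.eq_nil_or_concat' l with rfl | ⟨l', i, rfl⟩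
    · exact absurd hl2.symm (by simpa using hw)
    · refine ⟨i, ?_⟩
      have h1 : len (w * S i) ≤ l'.length := by
        refine Nat.find_min' _ ⟨l', rfl, ?_⟩
        rw [← hl2]
        simp [mul_assoc, hS]
      rw [List.length_append, List.length_singleton] at hl1
      change _ < Nat.find (hex w)
      omega
  obtain ⟨i, hi⟩ := hdesc w hw
  -- For a descent `i` of `w`, the element `w * S i` has `i` as an ascent, and `F (w * S i) i = -F w
  -- i`.
  have hneg := neg_of_len_le hS hcomm hdiag hF hF1 hdih hlen hdesc _ (w * S i) i rfl
    (by rw [mul_assoc, hS, mul_one]; exact hi.le)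
  rw [hF, hdiag] at hneg
  exact ⟨i, by linarith⟩

end Tits

/-! ### Coordinates of the hyperboloid model -/

/-- The time-like coordinate of a point on the hyperboloid: `cosh` of its distance from `i`. -/
def hypT (z : ℍ) : ℝ := (z.re ^ 2 + z.im ^ 2 + 1) / (2 * z.im)

/-- The first space-like coordinate of a point on the hyperboloid. -/
def hypX (z : ℍ) : ℝ := (z.re ^ 2 + z.im ^ 2 - 1) / (2 * z.im)

/-- The second space-like coordinate of a point on the hyperboloid. -/
def hypY (z : ℍ) : ℝ := -z.re / z.im

lemma hypT_sq (z : ℍ) : hypT z ^ 2 = 1 + hypX z ^ 2 + hypY z ^ 2 := by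
  have := z.im_ne_zero
  rw [hypT, hypX, hypY]
  field_simp
  ring

lemma hypT_pos (z : ℍ) : 0 < hypT z := by
  have := z.im_pos
  rw [hypT]
  positivity

lemma cosh_dist_eq (z w : ℍ) :
    cosh (dist z w) = hypT z * hypT w - hypX z * hypX w - hypY z * hypY w := by
  have h1 := z.im_ne_zero
  have h2 := w.im_ne_zero
  rw [cosh_dist, Complex.dist_eq, ← Complex.normSq_eq_norm_sq, Complex.normSq_apply,
    Complex.sub_re, Complex.sub_im, coe_re, coe_re, coe_im, coe_im, hypT, hypT, hypX, hypX, hypY,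
    hypY]
  field_simp
  ring

lemma hyp_I : hypT I = 1 ∧ hypX I = 0 ∧ hypY I = 0 := by
  simp [hypT, hypX, hypY, I]

lemma cosh_dist_I (z : ℍ) : cosh (dist I z) = hypT z := by
  rw [cosh_dist_eq, hyp_I.1, hyp_I.2.1, hyp_I.2.2]
  ring

lemma mirror_smul_re_im (a : ℝ) (z : ℍ) :
    (mirror a • z).re = exp a ^ 2 * z.re / (z.re ^ 2 + z.im ^ 2) ∧
      (mirror a • z).im = exp a ^ 2 * z.im / (z.re ^ 2 + z.im ^ 2) := by
  have ha := exp_pos a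
  have hz := z.im_pos
  have hdet : (mirrorMat a).det.val = -1 := by
    rw [Matrix.GeneralLinearGroup.val_det_apply, mirrorMat_val, Matrix.det_fin_two_of, ← exp_add]
    simp
  have hv := mirrorMat_val a
  have h01 : mirrorMat a 0 1 = exp a := by rw [hv]; rfl
  have h00 : mirrorMat a 0 0 = 0 := by rw [hv]; rfl
  have h10 : mirrorMat a 1 0 = (exp a)⁻¹ := by rw [hv, ← exp_neg]; rfl
  have h11 : mirrorMat a 1 1 = 0 := by rw [hv]; rfl
  rw [mirror, pglMk_smul]
  constructor
  · rw [re_smul, num, denom, h00, h01, h10, h11]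
    simp [Complex.div_re, Complex.normSq_apply, -Complex.ofReal_exp]
    field_simp
  · rw [im_smul_eq_div_normSq, hdet, denom, h10, h11]
    simp [Complex.normSq_apply, -Complex.ofReal_exp]
    field_simp

lemma hyp_mirror_smul (a : ℝ) (z : ℍ) :
    hypT (mirror a • z) = hypT z - 2 * sinh a * (cosh a * hypX z - sinh a * hypT z) ∧
      hypX (mirror a • z) = hypX z - 2 * cosh a * (cosh a * hypX z - sinh a * hypT z) ∧
      hypY (mirror a • z) = hypY z := by
  obtain ⟨h1, h2⟩ := mirror_smul_re_im a z
  have ha := exp_pos a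
  have hz := z.im_pos
  have hD : 0 < z.re ^ 2 + z.im ^ 2 := by positivity
  simp only [hypT, hypX, hypY, h1, h2]
  rw [cosh_eq, sinh_eq, exp_neg]
  refine ⟨?_, ?_, ?_⟩
  · field_simp
    ring
  · field_simp
    ring
  · field_simp

lemma rot_smul_re_im (θ : ℝ) (z : ℍ) :
    (rot θ • z).re = ((cos (θ / 2) * z.re + sin (θ / 2)) * (cos (θ / 2) - sin (θ / 2) * z.re) -
          cos (θ / 2) * sin (θ / 2) * z.im ^ 2) /
        ((cos (θ / 2) - sin (θ / 2) * z.re) ^ 2 + (sin (θ / 2) * z.im) ^ 2) ∧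
      (rot θ • z).im = z.im /
        ((cos (θ / 2) - sin (θ / 2) * z.re) ^ 2 + (sin (θ / 2) * z.im) ^ 2) := by
  have hdet : (rotMat θ).det.val = 1 := by
    rw [Matrix.GeneralLinearGroup.val_det_apply, rotMat_val, Matrix.det_fin_two_of]
    linarith [sin_sq_add_cos_sq (θ / 2)]
  have hv := rotMat_val θ
  have h01 : rotMat θ 0 1 = sin (θ / 2) := by rw [hv]; rfl
  have h00 : rotMat θ 0 0 = cos (θ / 2) := by rw [hv]; rfl
  have h10 : rotMat θ 1 0 = -sin (θ / 2) := by rw [hv]; rfl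
  have h11 : rotMat θ 1 1 = cos (θ / 2) := by rw [hv]; rfl
  rw [rot, pglMk_smul]
  constructor
  · rw [re_smul, num, denom, h00, h01, h10, h11]
    simp [Complex.div_re, Complex.normSq_apply, -Complex.ofReal_sin, -Complex.ofReal_cos]
    rw [← add_div]
    congr 1 <;> ring
  · rw [im_smul_eq_div_normSq, hdet, denom, h10, h11]
    simp [Complex.normSq_apply, -Complex.ofReal_sin, -Complex.ofReal_cos]
    congr 1
    ring

lemma hyp_rot_smul (θ : ℝ) (z : ℍ) :
    hypT (rot θ • z) = hypT z ∧
      hypX (rot θ • z) = cos θ * hypX z - sin θ * hypY z ∧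
      hypY (rot θ • z) = sin θ * hypX z + cos θ * hypY z := by
  obtain ⟨h1, h2⟩ := rot_smul_re_im θ z
  have hz := z.im_pos
  have hsc := sin_sq_add_cos_sq (θ / 2)
  have hD : 0 < (cos (θ / 2) - sin (θ / 2) * z.re) ^ 2 + (sin (θ / 2) * z.im) ^ 2 := by
    by_cases hs : sin (θ / 2) = 0
    · rw [hs] at hsc ⊢
      nlinarith
    · positivity
  have hc : cos θ = cos (θ / 2) ^ 2 - sin (θ / 2) ^ 2 := by
    rw [← cos_two_mul', mul_div_cancel₀ _ two_ne_zero]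
  have hs : sin θ = 2 * sin (θ / 2) * cos (θ / 2) := by
    rw [← sin_two_mul, mul_div_cancel₀ _ two_ne_zero]
  simp only [hypT, hypX, hypY, h1, h2, hc, hs]
  generalize sin (θ / 2) = s at *
  generalize cos (θ / 2) = c at *
  generalize z.re = x at *
  generalize z.im = y at *
  generalize hDD : (c - s * x) ^ 2 + (s * y) ^ 2 = D at *
  -- With `D = |c - s z|^2`, this is `|(c z + s) / (c - s z)|^2 = |c z + s|^2 / D` with denominators
  -- cleared.
  have hN : ((c * x + s) * (c - s * x) - c * s * y ^ 2) ^ 2 + y ^ 2 =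
      D * ((c * x + s) ^ 2 + (c * y) ^ 2) := by
    rw [← hDD]
    linear_combination (-(y ^ 2) * (s ^ 2 + c ^ 2 + 1)) * hsc
  have hT : (((c * x + s) * (c - s * x) - c * s * y ^ 2) / D) ^ 2 + (y / D) ^ 2 =
      ((c * x + s) ^ 2 + (c * y) ^ 2) / D := by
    field_simp
    linear_combination hN
  rw [hT]
  refine ⟨?_, ?_, ?_⟩
  · field_simp
    rw [← hDD]
    linear_combination (x ^ 2 + y ^ 2 + 1) * hsc
  · field_simp
    rw [← hDD]
    ring
  · field_simp
    ring

/-! ### Reflections in lines as Lorentz reflections -/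

/-- `sinh` of the signed distance of `z` from the line at distance `a` from `i` whose closest point
to `i` has direction `θ`; it is negative on the side of `i` if `0 < a`. -/
def sideFun (a θ : ℝ) (z : ℍ) : ℝ := cosh a * (cos θ * hypX z + sin θ * hypY z) - sinh a * hypT z

/-- This is `z ↦ z - 2⟨z, ν⟩ν` for the form `-TT' + XX' + YY'`, with unit normal `ν = (sinh a, cosh
a cos θ, cosh a sin θ)` and `⟨z, ν⟩ = sideFun a θ z`. -/
lemma hyp_reflection_smul (a θ : ℝ) (z : ℍ) :
    hypT ((rot θ * mirror a * (rot θ)⁻¹) • z) = hypT z - 2 * sinh a * sideFun a θ z ∧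
      hypX ((rot θ * mirror a * (rot θ)⁻¹) • z) =
        hypX z - 2 * cosh a * cos θ * sideFun a θ z ∧
      hypY ((rot θ * mirror a * (rot θ)⁻¹) • z) =
        hypY z - 2 * cosh a * sin θ * sideFun a θ z := by
  rw [mul_smul, mul_smul, ← rot_neg, sideFun]
  obtain ⟨t1, x1, y1⟩ := hyp_rot_smul (-θ) z
  obtain ⟨t2, x2, y2⟩ := hyp_mirror_smul a (rot (-θ) • z)
  obtain ⟨t3, x3, y3⟩ := hyp_rot_smul θ (mirror a • rot (-θ) • z)
  rw [t3, x3, y3, t2, x2, y2, t1, x1, y1, cos_neg, sin_neg]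
  have hsc := sin_sq_add_cos_sq θ
  refine ⟨by ring, ?_, ?_⟩
  · linear_combination hypX z * hsc
  · linear_combination hypY z * hsc

/-- Pairing the reflection formula with a second normal yields the transformation rule that Tits's
argument requires of `F`. -/
lemma sideFun_reflection_smul (a α θ : ℝ) (z : ℍ) :
    sideFun a α ((rot θ * mirror a * (rot θ)⁻¹) • z) =
      sideFun a α z + 2 * (sinh a ^ 2 - cosh a ^ 2 * cos (α - θ)) * sideFun a θ z := by
  obtain ⟨h1, h2, h3⟩ := hyp_reflection_smul a θ z
  rw [sideFun, h1, h2, h3, cos_sub, sideFun, sideFun]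
  ring

lemma dist_reflection_smul (a θ : ℝ) (z w : ℍ) :
    dist ((rot θ * mirror a * (rot θ)⁻¹) • z) ((rot θ * mirror a * (rot θ)⁻¹) • w) = dist z w := by
  apply cosh_injOn dist_nonneg dist_nonneg
  obtain ⟨h1, h2, h3⟩ := hyp_reflection_smul a θ z
  obtain ⟨h4, h5, h6⟩ := hyp_reflection_smul a θ w
  rw [cosh_dist_eq, cosh_dist_eq, h1, h2, h3, h4, h5, h6, sideFun, sideFun]
  have hsc := sin_sq_add_cos_sq θ
  have hch := cosh_sq a
  generalize cos θ = c at *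
  generalize sin θ = s at *
  have hc2 : c ^ 2 = 1 - s ^ 2 := by linarith
  generalize cosh a = C at *
  generalize sinh a = H at *
  linear_combination (-4 * C ^ 2 * (C * (c * hypX z + s * hypY z) - H * hypT z) *
    (C * (c * hypX w + s * hypY w) - H * hypT w)) * hsc - (4 *
    (C * (c * hypX z + s * hypY z) - H * hypT z) *
    (C * (c * hypX w + s * hypY w) - H * hypT w)) * hch

lemma sideFun_I (a θ : ℝ) : sideFun a θ I = -sinh a := by
  rw [sideFun, hyp_I.1, hyp_I.2.1, hyp_I.2.2]
  ring

/-- A point on the other side of a line at distance `a` from `i` has distance at least `a`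
from `i`. -/
lemma le_dist_of_sideFun_pos {a θ : ℝ} (ha : 0 ≤ a) {z : ℍ} (hz : 0 < sideFun a θ z) :
    a ≤ dist I z := by
  rw [← abs_of_nonneg ha, ← abs_of_nonneg (dist_nonneg (x := I) (y := z)), ← cosh_le_cosh,
    cosh_dist_I]
  rw [sideFun] at hz
  have h0 := hypT_pos z
  have h1 := hypT_sq z
  -- Cauchy–Schwarz. With `hz` it gives `sinh² a * T² < cosh² a * (T² - 1)`, that is, `cosh a < T`.
  have h2 : (cos θ * hypX z + sin θ * hypY z) ^ 2 ≤ hypX z ^ 2 + hypY z ^ 2 := by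
    have := sin_sq_add_cos_sq θ
    nlinarith [sq_nonneg (sin θ * hypX z - cos θ * hypY z)]
  have hC := cosh_pos a
  have hS := sinh_nonneg_iff.2 ha
  have hch := cosh_sq a
  have h3 : (sinh a * hypT z) ^ 2 < (cosh a * (cos θ * hypX z + sin θ * hypY z)) ^ 2 :=
    pow_lt_pow_left₀ (by linarith) (by positivity) two_ne_zero
  have h4 : cosh a ^ 2 * (cos θ * hypX z + sin θ * hypY z) ^ 2 ≤ cosh a ^ 2 * (hypT z ^ 2 - 1) :=
    mul_le_mul_of_nonneg_left (by linarith) (by positivity)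
  rw [← sq_le_sq₀ hC.le h0.le]
  nlinarith

/-! ### The orbit of the centre of the polygon is separated -/

lemma cheb_cos_mul_sin (φ : ℝ) (p : ℕ) : cheb (cos φ) p * sin φ = sin (p * φ) := by
  induction p using Nat.twoStepInduction with
  | zero => simp [cheb]
  | one => simp [cheb]
  | more p h0 h1 =>
    rw [cheb, sub_mul, mul_assoc, h0, h1]
    have e1 : ((p + 2 : ℕ) : ℝ) * φ = ((p + 1 : ℕ) : ℝ) * φ + φ := by push_cast; ring
    have e2 : (p : ℝ) * φ = ((p + 1 : ℕ) : ℝ) * φ - φ := by push_cast; ring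
    rw [e1, e2, sin_add, sin_sub]
    ring

/-- For `c ≥ 1` the increments of `cheb c` do not decrease, and the first one is 1. -/
lemma cheb_pos_of_one_le {c : ℝ} (hc : 1 ≤ c) {p : ℕ} (hp : 0 < p) : 0 < cheb c p := by
  have h : ∀ p, 0 ≤ cheb c p ∧ cheb c p + 1 ≤ cheb c (p + 1) := by
    intro p
    induction p with
    | zero => simp [cheb]
    | succ p ih =>
      obtain ⟨h1, h2⟩ := ih
      refine ⟨by linarith, ?_⟩
      rw [cheb]
      nlinarith
  obtain ⟨k, rfl⟩ : ∃ k, p = k + 1 := ⟨p - 1, by omega⟩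
  linarith [(h k).1, (h k).2]

/-- The direction of the `k`-th side of the polygon. -/
def sideAngle (n : ℕ) (k : ZMod n) : ℝ := 2 * (k.val : ℝ) * (π / n)

/-- Minus the product of the unit normals of two sides of the polygon. -/
def sideCoeff (n m : ℕ) (i j : ZMod n) : ℝ :=
  sinh (inradius n m) ^ 2 - cosh (inradius n m) ^ 2 * cos (sideAngle n i - sideAngle n j)

section Polygon

variable {n m : ℕ}

lemma sideReflection_eq (k : ZMod n) : sideReflection n m k =
    rot (sideAngle n k) * mirror (inradius n m) * (rot (sideAngle n k))⁻¹ := rfl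

lemma sideCoeff_comm (i j : ZMod n) : sideCoeff n m i j = sideCoeff n m j i := by
  rw [sideCoeff, sideCoeff, ← cos_neg, neg_sub]

lemma sideCoeff_self (i : ZMod n) : sideCoeff n m i i = -1 := by
  rw [sideCoeff, sub_self, cos_zero, cosh_sq]
  ring

lemma IsHyperbolicPair.sin_pos (h : IsHyperbolicPair n m) : 0 < sin (π / n) := by
  obtain ⟨h1, h2, h3⟩ := h.angles
  exact sin_pos_of_pos_of_lt_pi h1 (by linarith)

lemma cosh_inradius_mul_sin (h : IsHyperbolicPair n m) :
    cosh (inradius n m) * sin (π / n) = cos (π / m) := by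
  rw [cosh_inradius h, div_mul_cancel₀ _ h.sin_pos.ne']

lemma inradius_pos (h : IsHyperbolicPair n m) : 0 < inradius n m := by
  obtain ⟨h1, h2, h3⟩ := h.angles
  apply arcosh_pos
  rw [one_lt_div h.sin_pos, ← cos_pi_div_two_sub]
  exact cos_lt_cos_of_nonneg_of_le_pi h2.le (by linarith) (by linarith)

/-- Adjacent sides meet at the interior angle `2π/m`, so minus the product of their outward normals
is its cosine. -/
lemma sideCoeff_succ (h : IsHyperbolicPair n m) (k : ZMod n) :
    sideCoeff n m k (k + 1) = cos (2 * (π / m)) := by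
  have hn : (n : ℝ) * (π / n) = π := by
    have := h.three_le
    have : (n : ℝ) ≠ 0 := by positivity
    field_simp
  have hcos : cos (sideAngle n k - sideAngle n (k + 1)) = cos (2 * (π / n)) := by
    rw [← cos_neg, neg_sub, sideAngle, sideAngle]
    rcases val_succ h k with e | e
    · rw [e]; congr 1; ring
    · rw [e, ← cos_add_two_pi]; congr 1; linear_combination -2 * hn
  rw [sideCoeff, hcos, cos_two_mul (π / n), cos_two_mul (π / m), ← cosh_inradius_mul_sin h,
    sinh_sq]
  linear_combination (-2 * cosh (inradius n m) ^ 2) * sin_sq_add_cos_sq (π / n)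

/-- Directions of non-adjacent sides differ by at least `4π/n`, which forces `n ≥ 4`. The
coefficient is then at least `8 cos²(π/m) cos²(π/n) - 1`, and both squared cosines are at least
`1/2`. -/
lemma one_le_sideCoeff (h : IsHyperbolicPair n m) {i j : ZMod n} (hij : i.val < j.val)
    (h1 : j ≠ i + 1) (h2 : i ≠ j + 1) : 1 ≤ sideCoeff n m i j := by
  have h3 := h.three_le
  have : NeZero n := ⟨by omega⟩
  have hi := ZMod.val_lt i
  have hj := ZMod.val_lt j
  have hd2 : i.val + 2 ≤ j.val := by
    by_contra hc
    apply h1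
    rw [← ZMod.natCast_zmod_val j, show j.val = i.val + 1 by omega, Nat.cast_add,
      ZMod.natCast_zmod_val, Nat.cast_one]
  have hdn : j.val + 2 ≤ i.val + n := by
    by_contra hc
    apply h2
    rw [← ZMod.natCast_zmod_val j, show j.val = n - 1 by omega, ← Nat.cast_succ,
      show (n - 1).succ = n by omega, ZMod.natCast_self, ← ZMod.val_eq_zero]
    omega
  have hnR : (4 : ℝ) ≤ n := by exact_mod_cast (show 4 ≤ n by omega)
  have hmR : (4 : ℝ) ≤ m := by exact_mod_cast h.four_le
  have hd2' : (i.val : ℝ) + 2 ≤ j.val := by exact_mod_cast hd2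
  have hdn' : (j.val : ℝ) + 2 ≤ i.val + n := by exact_mod_cast hdn
  obtain ⟨a1, a2, a3⟩ := h.angles
  have hn : (n : ℝ) * (π / n) = π := by field_simp
  have hn4 : π / n ≤ π / 4 := div_le_div_of_nonneg_left pi_pos.le (by norm_num) hnR
  have hm4 : π / m ≤ π / 4 := div_le_div_of_nonneg_left pi_pos.le (by norm_num) hmR
  have hcos : cos (sideAngle n i - sideAngle n j) ≤ cos (4 * (π / n)) := by
    rw [← cos_neg, neg_sub, sideAngle, sideAngle]
    have e1 : 4 * (π / n) ≤ 2 * (j.val : ℝ) * (π / n) - 2 * (i.val : ℝ) * (π / n) := by nlinarith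
    have e2 : 2 * (j.val : ℝ) * (π / n) - 2 * (i.val : ℝ) * (π / n) ≤ 2 * π - 4 * (π / n) := by
      nlinarith
    generalize 2 * (j.val : ℝ) * (π / n) - 2 * (i.val : ℝ) * (π / n) = x at *
    rcases le_total x π with hx | hx
    · exact cos_le_cos_of_nonneg_of_le_pi (by linarith) hx e1
    · rw [← cos_two_pi_sub x]
      exact cos_le_cos_of_nonneg_of_le_pi (by linarith) (by linarith) (by linarith)
  have hsq : ∀ x, 0 ≤ x → x ≤ π / 4 → 1 / 2 ≤ cos x ^ 2 := by
    intro x h0 hx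
    have := cos_le_cos_of_nonneg_of_le_pi h0 (by linarith [pi_pos]) hx
    rw [cos_pi_div_four] at this
    have h22 : (√2 / 2) ^ 2 = 1 / 2 := by rw [div_pow, sq_sqrt (by norm_num)]; norm_num
    rw [← h22]
    exact pow_le_pow_left₀ (by positivity) this 2
  have hb := hsq _ a2.le hm4
  have hc := hsq _ a1.le hn4
  have hkey : cosh (inradius n m) ^ 2 * (1 - cos (4 * (π / n))) =
      8 * cos (π / m) ^ 2 * cos (π / n) ^ 2 := by
    rw [← cosh_inradius_mul_sin h, show 4 * (π / n) = 2 * (2 * (π / n)) by ring, cos_two_mul,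
      ← sub_eq_zero]
    have := sin_sq_add_cos_sq (2 * (π / n))
    have e : cos (2 * (π / n)) ^ 2 = 1 - (2 * sin (π / n) * cos (π / n)) ^ 2 := by
      rw [← sin_two_mul]; linarith
    rw [e]
    ring
  have := mul_le_mul_of_nonneg_left hcos (sq_nonneg (cosh (inradius n m)))
  rw [sideCoeff, sinh_sq]
  nlinarith [mul_nonneg (sub_nonneg.2 hb) (sub_nonneg.2 hc)]

/-! ### The presentation and the separation of the orbit -/

/-- The generators of `Γ_{n,m}`. -/
def gen (n m : ℕ) (i : ZMod n) : Gam n m := PresentedGroup.of i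

lemma gen_mul_self (i : ZMod n) : gen n m i * gen n m i = 1 := by
  have : PresentedGroup.mk (relators n m) (FreeGroup.of i ^ 2) = 1 :=
    PresentedGroup.one_of_mem (Or.inl ⟨i, rfl⟩)
  rw [map_pow, pow_two] at this
  exact this

lemma gen_mul_succ_pow (i : ZMod n) : (gen n m i * gen n m (i + 1)) ^ (m / 2) = 1 := by
  have : PresentedGroup.mk (relators n m)
      ((FreeGroup.of i * FreeGroup.of (i + 1)) ^ (m / 2)) = 1 :=
    PresentedGroup.one_of_mem (Or.inr ⟨i, rfl⟩)
  rw [map_pow, map_mul] at this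
  exact this

lemma action_gen (h : IsHyperbolicPair n m) (i : ZMod n) :
    action h (gen n m i) = sideReflection n m i :=
  PresentedGroup.toGroup.of _

lemma dihedralCondition_of_cos (h : IsHyperbolicPair n m) (g : Gam n m) (hg : g ^ (m / 2) = 1) :
    DihedralCondition (cos (2 * (π / m))) g := by
  obtain ⟨a1, a2, a3⟩ := h.angles
  obtain ⟨l, hl⟩ := h.even
  have h4 := h.four_le
  have hmR : (m : ℝ) = 2 * (m / 2 : ℕ) := by
    rw [show m / 2 = l by omega, hl]; push_cast; ring
  have hqφ : ((m / 2 : ℕ) : ℝ) * (2 * (π / m)) = π := by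
    have : (m : ℝ) ≠ 0 := by positivity
    calc ((m / 2 : ℕ) : ℝ) * (2 * (π / m)) = (2 * (m / 2 : ℕ)) * (π / m) := by ring
      _ = π := by rw [← hmR]; field_simp
  have hsin : 0 < sin (2 * (π / m)) := sin_pos_of_pos_of_lt_pi (by linarith) (by linarith)
  -- With `φ = 2π/m`, `U_p = sin (pφ) / sin φ` is positive until `pφ` reaches `π`, which happens
  -- exactly at `p = m / 2`.
  refine Or.inr ⟨m / 2, by omega, hg, ?_, ?_⟩
  · intro p hp hpq
    refine pos_of_mul_pos_left ?_ hsin.le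
    rw [cheb_cos_mul_sin]
    have hp' : (0 : ℝ) < p := by exact_mod_cast hp
    have hpq' : (p : ℝ) < (m / 2 : ℕ) := by exact_mod_cast hpq
    apply sin_pos_of_pos_of_lt_pi (by positivity)
    exact (mul_lt_mul_of_pos_right hpq' (by linarith)).trans_eq hqφ
  · refine nonneg_of_mul_nonneg_left ?_ hsin
    rw [cheb_cos_mul_sin, hqφ, sin_pi]

lemma dihedralCondition_gen (h : IsHyperbolicPair n m) {i j : ZMod n} (hij : i ≠ j) :
    DihedralCondition (sideCoeff n m i j) (gen n m i * gen n m j) := by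
  have h3 := h.three_le
  have : NeZero n := ⟨by omega⟩
  by_cases h1 : j = i + 1
  · rw [h1, sideCoeff_succ h]
    exact dihedralCondition_of_cos h _ (gen_mul_succ_pow i)
  by_cases h2 : i = j + 1
  · rw [sideCoeff_comm, h2, sideCoeff_succ h]
    apply dihedralCondition_of_cos h
    have e : gen n m (j + 1) * gen n m j = (gen n m j * gen n m (j + 1))⁻¹ := by
      rw [mul_inv_rev, inv_eq_of_mul_eq_one_right (gen_mul_self j),
        inv_eq_of_mul_eq_one_right (gen_mul_self (j + 1))]
    rw [e, inv_pow, gen_mul_succ_pow, inv_one]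
  · left
    intro p hp
    refine cheb_pos_of_one_le ?_ hp
    rcases lt_or_gt_of_ne (fun e => hij (ZMod.val_injective n e)) with hlt | hlt
    · exact one_le_sideCoeff h hlt h1 h2
    · rw [sideCoeff_comm]
      exact one_le_sideCoeff h hlt h2 h1

lemma dist_action_smul (h : IsHyperbolicPair n m) (g : Gam n m) (z w : ℍ) :
    dist (action h g • z) (action h g • w) = dist z w := by
  let H : Subgroup (Gam n m) :=
    { carrier := {g | ∀ z w : ℍ, dist (action h g • z) (action h g • w) = dist z w}
      one_mem' := by intro z w; rw [map_one, one_smul, one_smul]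
      mul_mem' := by
        intro a b ha hb z w
        rw [map_mul, mul_smul, mul_smul, ha, hb]
      inv_mem' := by
        intro a ha z w
        rw [← ha, ← mul_smul, ← mul_smul, ← map_mul, mul_inv_cancel, map_one, one_smul,
          one_smul] }
  refine PresentedGroup.generated_by (relators n m) H (fun i z w => ?_) g z w
  change dist (action h (gen n m i) • z) (action h (gen n m i) • w) = dist z w
  rw [action_gen, sideReflection_eq, dist_reflection_smul]

/-- The action is faithful, and moves the centre of the polygon at least by the inradius. -/
theorem inradius_le_dist (h : IsHyperbolicPair n m) {g : Gam n m} (hg : g ≠ 1) :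
    inradius n m ≤ dist I (action h g • I) := by
  obtain ⟨i, hi⟩ := exists_pos_of_ne_one (S := gen n m) (c := sideCoeff n m)
    (F := fun w i => sideFun (inradius n m) (sideAngle n i) (action h w⁻¹ • I))
    gen_mul_self (PresentedGroup.closure_range_of _) sideCoeff_comm sideCoeff_self
    (fun w i j => by
      rw [mul_inv_rev, inv_eq_of_mul_eq_one_right (gen_mul_self j), map_mul, mul_smul, action_gen,
        sideReflection_eq, sideFun_reflection_smul, sideCoeff])
    (fun i => by
      rw [inv_one, map_one, one_smul, sideFun_I]
      exact neg_neg_of_pos (sinh_pos_iff.2 (inradius_pos h)))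
    -- `F` involves the inverse of its argument, so evaluating it at `g⁻¹` places `g • I` beyond
    -- side `i`.
    (fun i j => dihedralCondition_gen h) g⁻¹ (inv_ne_one.2 hg)
  rw [inv_inv] at hi
  exact le_dist_of_sideFun_pos (inradius_nonneg h) hi

theorem inradius_le_dist_of_ne (h : IsHyperbolicPair n m) {g g' : Gam n m} (hg : g ≠ g') :
    inradius n m ≤ dist (action h g • I) (action h g' • I) := by
  rw [← dist_action_smul h g⁻¹, ← mul_smul, ← mul_smul, ← map_mul, ← map_mul, inv_mul_cancel,
    map_one, one_smul]
  exact inradius_le_dist h (fun e => hg (inv_mul_eq_one.1 e))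

/-! ### The orbit of the centre of the polygon is relatively dense -/

/-- Every vector makes an angle at most `π / n` with the direction of some side. -/
lemma exists_side_direction (h : IsHyperbolicPair n m) (w : ℂ) :
    ∃ k : ZMod n, ‖w‖ * cos (π / n) ≤
      cos (sideAngle n k) * w.re + sin (sideAngle n k) * w.im := by
  have h3 := h.three_le
  have : NeZero n := ⟨by omega⟩
  have hn0 : (n : ℝ) ≠ 0 := by positivity
  obtain ⟨a1, a2, a3⟩ := h.angles
  set N : ℤ := round (w.arg / (2 * (π / n))) with hN
  have hr := abs_sub_round (w.arg / (2 * (π / n)))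
  rw [← hN] at hr
  have habs : |w.arg - 2 * N * (π / n)| ≤ π / n := by
    have e : w.arg - 2 * N * (π / n) = (w.arg / (2 * (π / n)) - N) * (2 * (π / n)) := by
      field_simp
    rw [e, abs_mul, abs_of_pos (show 0 < 2 * (π / n) by linarith)]
    nlinarith
  refine ⟨(N : ZMod n), ?_⟩
  have hval : ((N : ZMod n).val : ℤ) = N % n := ZMod.val_intCast N
  have hval' : (((N : ZMod n).val : ℤ) : ℝ) = N - n * (N / n : ℤ) := by
    rw [hval, Int.emod_def]; push_cast; ring
  rw [Int.cast_natCast] at hval'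
  -- Reducing the nearest index `N` modulo `n` changes the direction by full turns only.
  have hang : sideAngle n (N : ZMod n) = 2 * N * (π / n) - (N / n : ℤ) * (2 * π) := by
    rw [sideAngle, hval']
    field_simp
  have hcos : cos (w.arg - sideAngle n (N : ZMod n)) = cos (w.arg - 2 * N * (π / n)) := by
    rw [hang, ← cos_add_int_mul_two_pi (w.arg - 2 * N * (π / n)) (N / n : ℤ)]
    congr 1
    ring
  have hre : w.re = ‖w‖ * cos w.arg := (Complex.norm_mul_cos_arg w).symm
  have him : w.im = ‖w‖ * sin w.arg := (Complex.norm_mul_sin_arg w).symm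
  rw [hre, him]
  have e : cos (sideAngle n (N : ZMod n)) * (‖w‖ * cos w.arg) +
      sin (sideAngle n (N : ZMod n)) * (‖w‖ * sin w.arg) =
      ‖w‖ * cos (w.arg - sideAngle n (N : ZMod n)) := by
    rw [cos_sub]; ring
  rw [e, hcos]
  apply mul_le_mul_of_nonneg_left _ (norm_nonneg w)
  rw [← cos_abs (w.arg - _)]
  exact cos_le_cos_of_nonneg_of_le_pi (abs_nonneg _) (by linarith) habs

/-- Equivalent to `tanh a < cos (π/n)`, which holds because the vertices lie at finite distance; it
makes the polygon bounded. -/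
lemma sinh_inradius_lt (h : IsHyperbolicPair n m) :
    sinh (inradius n m) < cosh (inradius n m) * cos (π / n) := by
  obtain ⟨a1, a2, a3⟩ := h.angles
  have hc : 0 < cos (π / n) := cos_pos_of_mem_Ioo ⟨by linarith, by linarith⟩
  have ht := tanh_inradius h
  rw [tanh_eq_sinh_div_cosh, div_eq_iff (cosh_pos _).ne'] at ht
  have h1 : tanh (circumradius n m) < 1 := tanh_lt_one _
  rw [ht]
  have := mul_pos hc (cosh_pos (inradius n m))
  nlinarith

/-- A neighbourhood of the polygon is bounded. -/
lemma hypT_le_of_sideFun_le_one (h : IsHyperbolicPair n m) (z : ℍ)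
    (hz : ∀ k, sideFun (inradius n m) (sideAngle n k) z ≤ 1) :
    hypT z ≤ (1 + cosh (inradius n m) * cos (π / n)) /
      (cosh (inradius n m) * cos (π / n) - sinh (inradius n m)) := by
  obtain ⟨k, hk⟩ := exists_side_direction h ⟨hypX z, hypY z⟩
  have hk' := hz k
  have hlt := sinh_inradius_lt h
  obtain ⟨a1, a2, a3⟩ := h.angles
  have hc : 0 < cos (π / n) := cos_pos_of_mem_Ioo ⟨by linarith, by linarith⟩
  have hC := cosh_pos (inradius n m)
  rw [le_div_iff₀ (by linarith)]
  -- The spatial part has norm `√(T² - 1) ≥ T - 1`, so the side nearest in direction gives an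
  -- inequality linear in `T`.
  have hr : hypT z - 1 ≤ ‖(⟨hypX z, hypY z⟩ : ℂ)‖ := by
    apply le_of_sq_le_sq _ (norm_nonneg _)
    rw [← Complex.normSq_eq_norm_sq, Complex.normSq_apply]
    nlinarith [hypT_sq z, hypT_pos z]
  rw [sideFun] at hk'
  dsimp only at hk
  have h1 := mul_le_mul_of_nonneg_left hk hC.le
  have h2 := mul_le_mul_of_nonneg_left hr (mul_pos hC hc).le
  nlinarith

/-- Every point can be moved by `Γ_{n,m}` to within a bounded distance of the centre of the
polygon. -/
theorem exists_dist_action_smul_le (h : IsHyperbolicPair n m) :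
    ∃ M : ℝ, ∀ z : ℍ, ∃ g : Gam n m, dist (action h g • I) z ≤ M := by
  set M := (1 + cosh (inradius n m) * cos (π / n)) /
      (cosh (inradius n m) * cos (π / n) - sinh (inradius n m)) with hM
  have hs : 0 < 2 * sinh (inradius n m) := by
    have := sinh_pos_iff.2 (inradius_pos h); linarith
  -- The threshold 1 for `sideFun`, rather than 0, makes each reflection lower `T` by more than `2
  -- sinh a`, so the descent is finite.
  have key : ∀ N : ℕ, ∀ z : ℍ, hypT z ≤ N * (2 * sinh (inradius n m)) →
      ∃ g : Gam n m, hypT (action h g • z) ≤ M := by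
    intro N
    induction N with
    | zero => intro z hz; have := hypT_pos z; simp at hz; linarith
    | succ N ih =>
      intro z hz
      by_cases hall : ∀ k, sideFun (inradius n m) (sideAngle n k) z ≤ 1
      · exact ⟨1, by rw [map_one, one_smul]; exact hypT_le_of_sideFun_le_one h z hall⟩
      · push Not at hall
        obtain ⟨k, hk⟩ := hall
        obtain ⟨g, hg⟩ := ih (sideReflection n m k • z) (by
          rw [sideReflection_eq, (hyp_reflection_smul _ _ z).1]
          push_cast at hz
          nlinarith)
        refine ⟨g * gen n m k, ?_⟩
        rwa [map_mul, mul_smul, action_gen]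
  refine ⟨M, fun z => ?_⟩
  obtain ⟨N, hN⟩ := exists_nat_ge (hypT z / (2 * sinh (inradius n m)))
  obtain ⟨g, hg⟩ := key N z ((div_le_iff₀ hs).1 hN)
  refine ⟨g⁻¹, ?_⟩
  rw [← dist_action_smul h g, ← mul_smul, ← map_mul, mul_inv_cancel, map_one, one_smul]
  -- Since `d ≤ sinh d < cosh d = T`, the bound on `T` also bounds the distance.
  have h1 := cosh_dist_I (action h g • z)
  have h2 := self_le_sinh_iff.2 (dist_nonneg (x := I) (y := action h g • z))
  have h3 := sinh_lt_cosh (dist I (action h g • z))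
  linarith

end Polygon

/-! ### Counting points in hyperbolic balls -/

section Counting

/-- Two points in the same cell of a grid are close. -/
lemma dist_le_of_cell {ε : ℝ} (hε : 0 < ε) (hε1 : ε ≤ 1) {z w : ℍ}
    (hj : ⌊log z.im / ε⌋ = ⌊log w.im / ε⌋)
    (hk : ⌊z.re / (ε * exp (ε * ⌊log z.im / ε⌋))⌋ = ⌊w.re / (ε * exp (ε * ⌊log w.im / ε⌋))⌋) :
    dist z w ≤ 3 * ε := by
  have him : ∀ z : ℍ, exp (ε * ⌊log z.im / ε⌋) ≤ z.im ∧
      z.im ≤ exp (ε * ⌊log z.im / ε⌋) * exp ε := by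
    intro z
    have h1 := Int.floor_le (log z.im / ε)
    have h2 := (Int.lt_floor_add_one (log z.im / ε)).le
    rw [le_div_iff₀ hε] at h1
    rw [div_le_iff₀ hε] at h2
    rw [← exp_add]
    constructor
    · rw [← le_log_iff_exp_le z.im_pos]; linarith
    · rw [← log_le_iff_le_exp z.im_pos]; linarith
  have hz := him z
  have hw := him w
  have he : 0 < exp (ε * ⌊log z.im / ε⌋) := exp_pos _
  rw [← hj] at hw hk
  generalize exp (ε * ⌊log z.im / ε⌋) = e at *
  have hre : |z.re - w.re| ≤ ε * e := by
    have h := (Int.abs_sub_lt_one_of_floor_eq_floor hk).le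
    rwa [← sub_div, abs_div, abs_of_pos (mul_pos hε he), div_le_one (mul_pos hε he)] at h
  have hexp : exp ε ≤ 1 + 2 * ε := by
    have h := abs_exp_sub_one_le (x := ε) (by rwa [abs_of_pos hε])
    rw [abs_of_pos hε] at h
    linarith [le_abs_self (exp ε - 1)]
  have him' : |z.im - w.im| ≤ 2 * ε * e := by
    rw [abs_le]
    constructor <;> nlinarith
  have hd : dist (z : ℂ) w ≤ 3 * ε * e := by
    rw [Complex.dist_eq]
    have h := Complex.norm_le_abs_re_add_abs_im ((z : ℂ) - w)
    rw [Complex.sub_re, Complex.sub_im, coe_re, coe_re, coe_im, coe_im] at h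
    linarith
  have hs : e ≤ √(z.im * w.im) := by
    apply le_sqrt_of_sq_le
    rw [pow_two]
    exact mul_le_mul hz.1 hw.1 he.le z.im_pos.le
  refine (dist_le_dist_coe_div_sqrt z w).trans ?_
  rw [div_le_iff₀ (he.trans_le hs)]
  exact hd.trans (mul_le_mul_of_nonneg_left hs (by positivity))

lemma exp_half_le_cosh (x : ℝ) : exp x / 2 ≤ cosh x := by
  rw [cosh_eq]
  linarith [exp_pos (-x)]

lemma cosh_le_exp {x : ℝ} (hx : 0 ≤ x) : cosh x ≤ exp x := by
  rw [cosh_eq]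
  linarith [exp_le_exp.2 (show -x ≤ x by linarith)]

variable {G : Type*} {o : G → ℍ}

/-- A separated family has at most linear times `e^R` members in the ball of radius `R`. -/
theorem exists_ncard_le_of_separated {δ : ℝ} (hδ : 0 < δ)
    (ho : ∀ g g', g ≠ g' → δ ≤ dist (o g) (o g')) :
    ∃ A B : ℝ, 0 < A ∧ 0 < B ∧ ∀ R, 0 ≤ R → {g | dist I (o g) ≤ R}.Finite ∧
      ({g | dist I (o g) ≤ R}.ncard : ℝ) ≤ (A * R + B) * exp R := by
  obtain ⟨ε, hε, hε1, hεδ⟩ : ∃ ε : ℝ, 0 < ε ∧ ε ≤ 1 ∧ 3 * ε < δ := by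
    refine ⟨min 1 (δ / 4), by positivity, min_le_left _ _, ?_⟩
    linarith [min_le_right 1 (δ / 4)]
  refine ⟨2 / ε * (6 / ε + 7), 7 * (6 / ε + 7), by positivity, by positivity, fun R hR => ?_⟩
  let J : G → ℤ := fun g => ⌊log (o g).im / ε⌋
  -- Cells have hyperbolic size comparable to `ε`, and `3 * ε < δ` allows one member in each. The
  -- ball meets `O(R)` rows, and `O(e^R)` columns in each row.
  let f : G → ℤ × ℤ := fun g => (J g, ⌊(o g).re / (ε * exp (ε * J g))⌋)
  set a : ℤ := ⌈R / ε⌉ + 1 with ha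
  set b : ℤ := ⌈3 * exp R / ε⌉ + 1 with hb
  let T : Finset (ℤ × ℤ) := Finset.Icc (-a) a ×ˢ Finset.Icc (-b) b
  have hfloor : ∀ x y : ℝ, |x| ≤ y → ⌊x⌋ ∈ Finset.Icc (-(⌈y⌉ + 1)) (⌈y⌉ + 1) := by
    intro x y hxy
    rw [abs_le] at hxy
    have h1 := Int.floor_le x
    have h2 := Int.lt_floor_add_one x
    have h3 := Int.le_ceil y
    rw [Finset.mem_Icc]
    constructor
    · rw [← @Int.cast_le ℝ]; push_cast; linarith
    · rw [← @Int.cast_le ℝ]; push_cast; linarith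
  have hmaps : ∀ g ∈ {g | dist I (o g) ≤ R}, f g ∈ (T : Set (ℤ × ℤ)) := by
    intro g hg
    rw [Set.mem_ofPred_eq] at hg
    have hy := (o g).im_pos
    have h1 : |log (o g).im| ≤ R := by
      have h := dist_log_im_le I (o g)
      rw [I_im, log_one, dist_zero_left, norm_eq_abs] at h
      exact h.trans hg
    have h2 : |(o g).re| ≤ exp R * (o g).im := by
      have hT : hypT (o g) ≤ exp R := by
        rw [← cosh_dist_I]
        exact (cosh_le_exp dist_nonneg).trans (exp_le_exp.2 hg)
      have hY : |hypY (o g)| ≤ hypT (o g) := by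
        apply abs_le_of_sq_le_sq _ (hypT_pos _).le
        nlinarith [hypT_sq (o g)]
      rw [hypY, abs_div, abs_neg, abs_of_pos hy, div_le_iff₀ hy] at hY
      exact hY.trans (mul_le_mul_of_nonneg_right hT hy.le)
    have h3 : (o g).im ≤ 3 * exp (ε * J g) := by
      have h := (Int.lt_floor_add_one (log (o g).im / ε)).le
      rw [div_le_iff₀ hε, log_le_iff_le_exp hy] at h
      calc (o g).im ≤ exp ((J g + 1) * ε) := h
        _ = exp ε * exp (ε * J g) := by rw [← exp_add]; congr 1; ring
        _ ≤ 3 * exp (ε * J g) := by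
          apply mul_le_mul_of_nonneg_right _ (exp_pos _).le
          linarith [exp_le_exp.2 hε1, exp_one_lt_d9]
    rw [Finset.mem_coe, Finset.mem_product]
    constructor
    · apply hfloor
      rw [abs_div, abs_of_pos hε]
      exact div_le_div_of_nonneg_right h1 hε.le
    · apply hfloor
      have he := exp_pos (ε * J g)
      rw [abs_div, abs_of_pos (mul_pos hε he), div_le_div_iff₀ (mul_pos hε he) hε]
      calc |(o g).re| * ε ≤ exp R * (3 * exp (ε * J g)) * ε := by gcongr; exact h2.trans (by gcongr)
        _ = 3 * exp R * (ε * exp (ε * J g)) := by ring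
  have hinj : Set.InjOn f {g | dist I (o g) ≤ R} := by
    intro g _ g' _ hgg
    by_contra hne
    have h := Prod.ext_iff.1 hgg
    have := dist_le_of_cell hε hε1 h.1 h.2
    linarith [ho g g' hne]
  refine ⟨Set.Finite.of_injOn hmaps hinj T.finite_toSet, ?_⟩
  have hcard := Set.ncard_le_ncard_of_injOn f hmaps hinj T.finite_toSet
  rw [Set.ncard_coe_finset, Finset.card_product, Int.card_Icc, Int.card_Icc] at hcard
  have ha0 : 0 ≤ R / ε := by positivity
  have hb0 : 0 ≤ 3 * exp R / ε := by positivity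
  have ha1 := Int.ceil_lt_add_one (R / ε)
  have hb1 := Int.ceil_lt_add_one (3 * exp R / ε)
  have ha2 := Int.ceil_nonneg ha0
  have hb2 := Int.ceil_nonneg hb0
  have hcast : ∀ k : ℤ, 0 ≤ k → (((k + 1 - -k).toNat : ℕ) : ℝ) = 2 * k + 1 := by
    intro k hk
    have : (((k + 1 - -k).toNat : ℤ) : ℝ) = ((k + 1 - -k : ℤ) : ℝ) := by
      rw [Int.toNat_of_nonneg (by omega)]
    rw [Int.cast_natCast] at this
    rw [this]; push_cast; ring
  have hcard' : ({g | dist I (o g) ≤ R}.ncard : ℝ) ≤ (2 * a + 1) * (2 * b + 1) := by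
    rw [← hcast a (by omega), ← hcast b (by omega)]
    exact_mod_cast hcard
  have haR : (2 * a + 1 : ℝ) ≤ 2 / ε * R + 7 := by
    rw [ha]; push_cast
    have : R / ε = 1 / ε * R := by ring
    have : 2 / ε * R = 2 * (1 / ε * R) := by ring
    linarith
  have hbR : (2 * b + 1 : ℝ) ≤ (6 / ε + 7) * exp R := by
    rw [hb]; push_cast
    have : 3 * exp R / ε = 3 / ε * exp R := by ring
    have : 6 / ε * exp R = 2 * (3 / ε * exp R) := by ring
    nlinarith [one_le_exp hR]
  have hb3 : (0 : ℝ) ≤ 2 * b + 1 := by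
    have : (0 : ℝ) ≤ b := by exact_mod_cast (show 0 ≤ b by omega)
    linarith
  refine hcard'.trans ((mul_le_mul haR hbR hb3 (by positivity)).trans_eq ?_)
  ring

/-- A relatively dense family has at least a constant times `e^R` members in the ball of
radius `R`. -/
theorem exists_le_ncard_of_dense {M : ℝ} (ho : ∀ z, ∃ g, dist (o g) z ≤ M)
    (hfin : ∀ R, 0 ≤ R → {g | dist I (o g) ≤ R}.Finite) :
    ∃ C : ℝ, 0 ≤ C ∧ ∀ R, 0 ≤ R → exp R ≤ {g | dist I (o g) ≤ R + C}.ncard := by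
  have hM : 0 ≤ M := by
    obtain ⟨g, hg⟩ := ho I
    exact dist_nonneg.trans hg
  set K := 2 * cosh (2 * M) with hK
  have hK2 : 2 ≤ K := by linarith [one_le_cosh (2 * M)]
  have hC : 0 ≤ log (K ^ 2 + 3) := log_nonneg (by nlinarith)
  refine ⟨log (K ^ 2 + 3) + M, by positivity, fun R hR => ?_⟩
  have hy := exp_pos (-R)
  -- Points on the horocycle `im = e^{-R}` at Euclidean spacing `K e^{-R}`: about `e^R` of them lie
  -- within `R + O(1)` of `I`. Here `1 + K²/2 > K/2 = cosh (2M)` keeps them more than `2M` apart, so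
  -- the group elements chosen near them are distinct.
  let p : ℕ → ℍ := fun k => ⟨⟨k * K * exp (-R), exp (-R)⟩, hy⟩
  choose s hs using ho
  let N := ⌊exp R⌋₊ + 1
  have hee : exp R * exp (-R) = 1 := by rw [← exp_add]; simp
  have hy1 : exp (-R) ≤ 1 := exp_le_one_iff.2 (by linarith)
  have hmaps : ∀ k ∈ (Finset.range N : Set ℕ),
      s (p k) ∈ {g | dist I (o g) ≤ R + (log (K ^ 2 + 3) + M)} := by
    intro k hk
    have hkR : (k : ℝ) ≤ exp R := by
      have h1 : k ≤ ⌊exp R⌋₊ := by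
        rw [Finset.mem_coe, Finset.mem_range] at hk; omega
      exact (Nat.cast_le.2 h1).trans (Nat.floor_le (exp_pos R).le)
    have hx : (k * K * exp (-R)) ^ 2 ≤ K ^ 2 := by
      apply pow_le_pow_left₀ (by positivity)
      calc k * K * exp (-R) ≤ exp R * K * exp (-R) := by gcongr
        _ = K * (exp R * exp (-R)) := by ring
        _ = K := by rw [hee, mul_one]
    have hT : hypT (p k) ≤ (K ^ 2 + 2) / 2 * exp R := by
      rw [hypT]
      change ((k * K * exp (-R)) ^ 2 + exp (-R) ^ 2 + 1) / (2 * exp (-R)) ≤ _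
      rw [div_le_iff₀ (by positivity)]
      have : (K ^ 2 + 2) / 2 * exp R * (2 * exp (-R)) = (K ^ 2 + 2) := by
        linear_combination (K ^ 2 + 2) * hee
      rw [this]
      nlinarith
    have hd : dist I (p k) ≤ log (K ^ 2 + 3) + R := by
      have h1 := exp_half_le_cosh (dist I (p k))
      rw [cosh_dist_I] at h1
      rw [← exp_le_exp, exp_add, exp_log (by positivity)]
      nlinarith [exp_pos R]
    have := dist_triangle_right I (o (s (p k))) (p k)
    rw [Set.mem_ofPred_eq]
    linarith [hs (p k)]
  have hinj : Set.InjOn (fun k => s (p k)) (Finset.range N : Set ℕ) := by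
    intro k _ l _ hkl
    by_contra hne
    dsimp only at hkl
    have h1 := hs (p k)
    have h2 := hs (p l)
    rw [← hkl] at h2
    have h3 : dist (p k) (p l) ≤ 2 * M := by
      linarith [dist_triangle_left (p k) (p l) (o (s (p k)))]
    have h4 : cosh (dist (p k) (p l)) ≤ cosh (2 * M) := by
      rw [cosh_le_cosh, abs_of_nonneg dist_nonneg, abs_of_nonneg (by linarith)]
      exact h3
    have h5 : cosh (dist (p k) (p l)) = 1 + K ^ 2 * ((k : ℝ) - l) ^ 2 / 2 := by
      rw [cosh_dist, Complex.dist_eq, ← Complex.normSq_eq_norm_sq, Complex.normSq_apply,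
        Complex.sub_re, Complex.sub_im]
      change 1 + ((k * K * exp (-R) - l * K * exp (-R)) * (k * K * exp (-R) - l * K * exp (-R)) +
        (exp (-R) - exp (-R)) * (exp (-R) - exp (-R))) / (2 * exp (-R) * exp (-R)) = _
      field_simp
      ring
    have h6 : 1 ≤ ((k : ℝ) - l) ^ 2 := by
      have hz : (k : ℤ) - l ≠ 0 := by omega
      have := Int.one_le_abs hz
      have h7 : (1 : ℤ) ≤ ((k : ℤ) - l) ^ 2 := by rw [← sq_abs]; nlinarith
      exact_mod_cast h7
    rw [h5] at h4
    nlinarith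
  have hcard := Set.ncard_le_ncard_of_injOn (fun k => s (p k)) hmaps hinj (hfin _ (by positivity))
  rw [Set.ncard_coe_finset, Finset.card_range] at hcard
  calc exp R ≤ (N : ℝ) := by
        have := (Nat.lt_floor_add_one (exp R)).le
        exact_mod_cast this
    _ ≤ _ := by exact_mod_cast hcard

end Counting

/-! ### The growth rate and the change of base point -/

/-- A sequence between two exponentials of rate `1`, up to a linear factor, has exponential growth
rate `1`. -/
lemma tendsto_log_div_of_bounds {b : ℕ → ℝ} {A B C D : ℝ} (hA : 0 < A) (hB : 0 < B) (hD : 0 ≤ D)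
    (hlow : ∀ k : ℕ, C ≤ k → exp (k - C) ≤ b k)
    (hup : ∀ k : ℕ, b k ≤ (A * (k + D) + B) * exp (k + D)) :
    Tendsto (fun k : ℕ => log (b k) / k) atTop (𝓝 1) := by
  have hinv : Tendsto (fun k : ℕ => ((k : ℝ))⁻¹) atTop (𝓝 0) :=
    tendsto_inv_atTop_zero.comp tendsto_natCast_atTop_atTop
  have hlog : Tendsto (fun k : ℕ => log (k : ℝ) / k) atTop (𝓝 0) := by
    have h := (tendsto_pow_log_div_mul_add_atTop 1 0 1 one_ne_zero).comp
      (tendsto_natCast_atTop_atTop (R := ℝ))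
    simpa [Function.comp_def] using h
  have hl : Tendsto (fun k : ℕ => 1 - C * (k : ℝ)⁻¹) atTop (𝓝 1) := by
    simpa using (hinv.const_mul C).const_sub 1
  have hu : Tendsto (fun k : ℕ => 1 + (log (A + A * D + B) + D) * (k : ℝ)⁻¹ + log (k : ℝ) / k)
      atTop (𝓝 1) := by
    simpa using ((hinv.const_mul (log (A + A * D + B) + D)).const_add 1).add hlog
  have hev : ∀ᶠ k : ℕ in atTop, 1 ≤ k ∧ C ≤ k :=
    (eventually_ge_atTop 1).and (tendsto_natCast_atTop_atTop.eventually_ge_atTop C)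
  refine tendsto_of_tendsto_of_tendsto_of_le_of_le' hl hu ?_ ?_
  · filter_upwards [hev] with k ⟨hk1, hkC⟩
    have hk : (0 : ℝ) < k := by exact_mod_cast hk1
    have h := log_le_log (exp_pos _) (hlow k hkC)
    rw [log_exp] at h
    rw [le_div_iff₀ hk]
    field_simp
    linarith
  · filter_upwards [hev] with k ⟨hk1, hkC⟩
    have hk : (1 : ℝ) ≤ k := by exact_mod_cast hk1
    have hk0 : (0 : ℝ) < k := by linarith
    have hb : 0 < b k := (exp_pos _).trans_le (hlow k hkC)
    have hpos : 0 < A + A * D + B := by positivity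
    have h1 : b k ≤ (A + A * D + B) * k * exp (k + D) := by
      refine (hup k).trans (mul_le_mul_of_nonneg_right ?_ (exp_pos _).le)
      nlinarith [mul_nonneg hA.le hD]
    have h := log_le_log hb h1
    rw [log_mul (by positivity) (exp_pos _).ne', log_mul hpos.ne' hk0.ne', log_exp] at h
    rw [div_le_iff₀ hk0]
    have e : (1 + (log (A + A * D + B) + D) * (k : ℝ)⁻¹ + log (k : ℝ) / k) * k =
        k + (log (A + A * D + B) + D) + log k := by
      field_simp
    linarith

theorem hasLogVolume_geomDist {n m : ℕ} (h : IsHyperbolicPair n m) (x₀ : ℍ) :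
    HasLogVolume (geomDist h x₀) 1 := by
  set D := 2 * dist I x₀ with hDdef
  have hD : 0 ≤ D := by positivity
  have hball : ∀ g : Gam n m, dist I (action h g • I) ≤ geomDist h x₀ 1 g + D ∧
      geomDist h x₀ 1 g ≤ dist I (action h g • I) + D := by
    intro g
    have e := dist_action_smul h g I x₀
    have h1 := dist_triangle4 I x₀ (action h g • x₀) (action h g • I)
    have h2 := dist_triangle4 x₀ I (action h g • I) (action h g • x₀)
    rw [dist_comm (action h g • x₀), e] at h1
    rw [dist_comm x₀ I, e] at h2
    rw [geomDist, map_one, one_smul]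
    constructor <;> linarith
  obtain ⟨A, B, hA, hB, hup⟩ := exists_ncard_le_of_separated (o := fun g => action h g • I)
    (inradius_pos h) (fun g g' => inradius_le_dist_of_ne h)
  obtain ⟨M, hM⟩ := exists_dist_action_smul_le h
  obtain ⟨C, hC, hlow⟩ := exists_le_ncard_of_dense (o := fun g => action h g • I) hM
    (fun R hR => (hup R hR).1)
  have hsub : ∀ R, groupBall (geomDist h x₀) R ⊆ {g | dist I (action h g • I) ≤ R + D} := by
    intro R g hg
    exact (hball g).1.trans (by linarith [show geomDist h x₀ 1 g ≤ R from hg])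
  have hfin : ∀ R, (groupBall (geomDist h x₀) R).Finite := by
    intro R
    -- The counting bound is for nonnegative radii, whereas `R` may be negative.
    refine (hup (|R| + D) (by positivity)).1.subset (fun g hg => ?_)
    have h1 : dist I (action h g • I) ≤ R + D := hsub R hg
    exact h1.trans (by linarith [le_abs_self R])
  refine ⟨hfin, ?_⟩
  refine tendsto_log_div_of_bounds (C := C + D) hA hB hD ?_ ?_
  · intro k hk
    refine (hlow (k - (C + D)) (by linarith)).trans ?_
    exact_mod_cast Set.ncard_le_ncard (fun g hg => by
      have h1 : dist I (action h g • I) ≤ k - (C + D) + C := hg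
      exact (hball g).2.trans (by linarith)) (hfin k)
  · intro k
    have hk : (0 : ℝ) ≤ k + D := by positivity
    refine le_trans ?_ (hup _ hk).2
    exact_mod_cast Set.ncard_le_ncard (hsub k) (hup _ hk).1

end

end HypCoxeter

theorem mainTheorem8 (n m : ℕ) (h : HypCoxeter.IsHyperbolicPair n m) (x₀ : UpperHalfPlane) :
    HypCoxeter.HasLogVolume (HypCoxeter.geomDist h x₀) 1 :=
  HypCoxeter.hasLogVolume_geomDist h x₀
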